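/- **Proposition (functional Hamilton–Jacobi equations in positive density space).** Let $\Omega\subset\mathbb R^d$ be the parallelepiped spanned by a basis of $\mathbb R^d$, with periodic boundary conditions, and let $\mathcal M=\{u\in C^\infty(\Omega): u>0\}$ be the space of smooth positive periodic functions. Let $V_1,V_2$ be smooth on $(0,\infty)$, each of them either positive or identically zero there, and let $\mathcal F:\mathcal M\to\mathbb R$ be a continuously differentiable functional with $L^2$ first variation $\frac{\delta}{\delta u}\mathcal F$. (The $L^2$ first variation of a functional $J$ at $u$ is the function $\delta$ with $\frac{d}{ds}J(c_s)|_{s=0}=\int_\Omega\delta\,\partial_sc_s|_{s=0}\,dx$ for all smooth curves $c$ with $c_0=u$; a functional $\mathcal U(t,u)$ is differentiable at $(t,u)$ if along smooth curves through $(t,u)$ in the domain of times and densities it is finite near $(t,u)$ and its derivative is given by a number $\partial_t\mathcal U(t,u)$ and a smooth periodic function $\frac{\delta}{\delta u}\mathcal U(t,u)$.) Given a set $D$ of admissible initial densities and an initial cost $\psi$ (a prescribed initial density $\mu$ is the case $D=\{\mu\}$, $\psi=0$), define the value functional of the mean-field control problem $$\mathcal U(t,w)=\inf\Big\{\psi(u(0))+\int_0^t\Big[\int_\Omega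 \tfrac12\|v_1\|^2V_1(u)+\tfrac12|v_2|^2V_2(u)\,dx-\mathcal F(u)\Big]ds\Big\},$$ where the infimum is over smooth curves $u$ in $\mathcal M$ and smooth controls $v_1$ (vector fields), $v_2$ (functions) with $\partial_su+\nabla\cdot(V_1(u)v_1)=v_2V_2(u)$ on $[0,t]\times\Omega$, $u(0)\in D$, $u(t)=w$. Put $$\mathcal H(u,\Phi)=\int_\Omega\big(\tfrac12\|\nabla\Phi\|^2V_1(u)+\tfrac12|\Phi|^2V_2(u)\big)dx+\mathcal F(u).$$ 1. Let $t\in(0,1]$ and $u\in\mathcal M$ be such that the infimum $\mathcal U(t,u)$ is attained and $\mathcal U$ (as a functional of times in $[0,1]$ and densities) is differentiable at $(t,u)$. Then at $(t,u)$ $$\partial_t\mathcal U(t,u)+\frac12\int_\Omega\Big\|\nabla\frac{\delta}{\delta u(x)}\mathcal U(t,u)\Big\|^2V_1(u)\,dx+\frac12\int_\Omega\Big|\frac{\delta}{\delta u(x)}\mathcal U(t,u)\Big|^2V_2(u)\,dx+\mathcal F(u)=0.\tag{HJ}$$ 2. Let $t\in(0,1]$, let $(u,v_1,v_2)$ be a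 minimizer of the problem defining $\mathcal U(t,u(t))$, let $\mathcal U$ be differentiable at $(s,u(s))$ for every $0<s<t$, and put $\Phi(s,x)=\frac{\delta}{\delta u(x)}\mathcal U(s,u(s))$. Then for $0<s<t$ the equation (HJ) holds at $(s,u(s))$, $v_1=\nabla\Phi$ where $V_1(u)\ne0$, $v_2=\Phi$ where $V_2(u)\neq0$, and $(u,\Phi)$ satisfies the Hamiltonian flow $$\begin{cases}\partial_su+\nabla\cdot(V_1(u)\nabla\Phi)=V_2(u)\Phi,\\ \partial_s\Phi+\frac12\|\nabla\Phi\|^2V_1'(u)+\frac12|\Phi|^2V_2'(u)+\frac{\delta}{\delta u}\mathcal F(u)=0.\end{cases}\tag{HF}$$ 3. (HF) is Hamilton's system for $\mathcal H$: for $u\in\mathcal M$ and $\Phi$ smooth and periodic, $\frac{\delta}{\delta\Phi}\mathcal H=-\nabla\cdot(V_1(u)\nabla\Phi)+V_2(u)\Phi$ and $\frac{\delta}{\delta u}\mathcal H=\frac12\|\nabla\Phi\|^2V_1'(u)+\frac12|\Phi|^2V_2'(u)+\frac{\delta}{\delta u}\mathcal F(u)$; thus (HF) reads $\partial_su=\frac{\delta}{\delta\Phi}\mathcal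 H$, $\partial_s\Phi=-\frac{\delta}{\delta u}\mathcal H$. 4. (HF) is the characteristic system of (HJ): if $\mathcal W:(t_0,t_1)\times\mathcal M\to\mathbb R$ is differentiable everywhere and solves (HJ), and $u$ is a smooth curve in $\mathcal M$ such that, with $\Phi(s,x)=\frac{\delta}{\delta u(x)}\mathcal W(s,u(s))$, the functions $\Phi$ and $\nabla\Phi$ are continuous on $(t_0,t_1)\times\Omega$ and $\partial_su=-\nabla\cdot(V_1(u)\nabla\Phi)+V_2(u)\Phi$ there, then $(u,\Phi)$ satisfies (HF) on $(t_0,t_1)$. -/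

import Mathlib

open Set Filter Topology MeasureTheory
open scoped ContDiff

namespace MeanField

noncomputable section

/-- The Euclidean space `ℝ^d`. -/
abbrev Pt (d : ℕ) : Type := EuclideanSpace ℝ (Fin d)

/-! The spatial domain `Ω` is the compact convex cell `parallelepiped b` spanned by a basis `b` of
`ℝ^d` (a rectangular box when `b` is orthogonal), with periodic boundary conditions: functions on
`Ω` are functions on `ℝ^d` which are invariant under the translations by the vectors `b i`. -/

/-- A `C^∞` function on `Ω` with periodic boundary conditions. -/
def IsSmoothPeriodic {d : ℕ} (b : Module.Basis (Fin d) ℝ (Pt d)) (f : Pt d → ℝ) : Prop :=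
  ContDiff ℝ ∞ f ∧ ∀ x i, f (x + b i) = f x

/-- The smooth positive density space `M(Ω)`. -/
def IsDensity {d : ℕ} (b : Module.Basis (Fin d) ℝ (Pt d)) (u : Pt d → ℝ) : Prop :=
  IsSmoothPeriodic b u ∧ ∀ x, 0 < u x

/-- A family of periodic functions on `Ω`, with values in `X`, which is smooth jointly in the
parameter `p` and in the point `x`. -/
def IsSmoothFamily {d : ℕ} {P X : Type*} [NormedAddCommGroup P] [NormedSpace ℝ P]
    [NormedAddCommGroup X] [NormedSpace ℝ X] (b : Module.Basis (Fin d) ℝ (Pt d))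
    (c : P → Pt d → X) : Prop :=
  ContDiff ℝ ∞ (fun q : P × Pt d => c q.1 q.2) ∧ ∀ p x i, c p (x + b i) = c p x

/-- A jointly smooth family of positive densities; for `P = ℝ`, a smooth curve in `M(Ω)`. -/
def IsDensityFamily {d : ℕ} {P : Type*} [NormedAddCommGroup P] [NormedSpace ℝ P]
    (b : Module.Basis (Fin d) ℝ (Pt d)) (c : P → Pt d → ℝ) : Prop :=
  IsSmoothFamily b c ∧ ∀ p x, 0 < c p x

/-- The divergence `∇ · m` of a vector field on `ℝ^d`. -/
def divergence {d : ℕ} (m : Pt d → Pt d) (x : Pt d) : ℝ :=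
  ∑ i : Fin d, fderiv ℝ (fun y => m y i) x (EuclideanSpace.single i 1)

/-- A mobility function: smooth on `(0, ∞)`, and there either positive or identically zero. -/
def IsMobility (V : ℝ → ℝ) : Prop :=
  ContDiffOn ℝ ∞ V (Ioi 0) ∧ ((∀ r, 0 < r → 0 < V r) ∨ (∀ r, 0 < r → V r = 0))

/-- `δ` is the `L²` first variation at the density `u` of the functional `J` on `M(Ω)`:
`d/ds J(c_s) = ∫_Ω δ ∂_s c dx` at `s = 0` for every smooth curve `c` in `M(Ω)` through `u`. -/
def HasFirstVariationAt {d : ℕ} (b : Module.Basis (Fin d) ℝ (Pt d))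
    (J : (Pt d → ℝ) → ℝ) (u δ : Pt d → ℝ) : Prop :=
  ∀ c : ℝ → Pt d → ℝ, IsDensityFamily b c → c 0 = u →
    HasDerivAt (fun s => J (c s))
      (∫ x in parallelepiped b, δ x * deriv (fun s => c s x) 0) 0

/-- `δ` is the `L²` first variation at `Φ` of the functional `J` on the space of all smooth
periodic functions (not necessarily positive). -/
def HasFreeFirstVariationAt {d : ℕ} (b : Module.Basis (Fin d) ℝ (Pt d))
    (J : (Pt d → ℝ) → ℝ) (Φ δ : Pt d → ℝ) : Prop :=
  ∀ c : ℝ → Pt d → ℝ, IsSmoothFamily b c → c 0 = Φ →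
    HasDerivAt (fun s => J (c s))
      (∫ x in parallelepiped b, δ x * deriv (fun s => c s x) 0) 0

/-- `F` is a continuously differentiable energy functional on `M(Ω)` with `L²` first variation
`dF u = δF/δu`; the latter depends continuously on `u`, along smooth families. -/
structure IsEnergy {d : ℕ} (b : Module.Basis (Fin d) ℝ (Pt d))
    (F : (Pt d → ℝ) → ℝ) (dF : (Pt d → ℝ) → Pt d → ℝ) : Prop where
  periodic : ∀ u, IsDensity b u → ∀ x i, dF u (x + b i) = dF u x
  variation : ∀ u, IsDensity b u → HasFirstVariationAt b F u (dF u)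
  continuous : ∀ c : ℝ × ℝ → Pt d → ℝ, IsDensityFamily b c →
    Continuous (fun q : (ℝ × ℝ) × Pt d => dF (c q.1) q.2)

/-- The functional `𝒰(t, u)` (time `t` in the interval `S`, density `u`) is differentiable at
`(t, w)`, with time derivative `∂_t 𝒰 = τ` and smooth `L²` first variation `δ𝒰/δu = Φ`: along every
smooth curve `r ↦ (θ r, c r)` in `S × M(Ω)` that passes through `(t, w)` at `r = 0`, the functional
is finite near `r = 0` and has there the derivative `θ'(0) τ + ∫_Ω Φ ∂_r c dx`. -/
def HasSpaceTimeVariationAt {d : ℕ} (b : Module.Basis (Fin d) ℝ (Pt d)) (S : Set ℝ)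
    (𝒰 : ℝ → (Pt d → ℝ) → EReal) (t : ℝ) (w : Pt d → ℝ) (τ : ℝ) (Φ : Pt d → ℝ) : Prop :=
  IsSmoothPeriodic b Φ ∧
  ∀ (θ : ℝ → ℝ) (c : ℝ → Pt d → ℝ), ContDiff ℝ ∞ θ → IsDensityFamily b c → θ 0 = t → c 0 = w →
    ∃ g : ℝ → ℝ, (∀ᶠ r in 𝓝[θ ⁻¹' S] 0, 𝒰 (θ r) (c r) = (g r : EReal)) ∧
      HasDerivWithinAt g
        (deriv θ 0 * τ + ∫ x in parallelepiped b, Φ x * deriv (fun r => c r x) 0) (θ ⁻¹' S) 0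

/-- `(u, v₁, v₂)` is an admissible controlled path on the time interval `[a, b']`: a smooth curve of
positive densities, a smooth transport control `v₁` and a smooth reaction control `v₂`, with
`∂_t u + ∇ · (V₁(u) v₁) = v₂ V₂(u)` on `[a, b'] × Ω`. -/
structure IsControlledPath {d : ℕ} (b : Module.Basis (Fin d) ℝ (Pt d)) (V₁ V₂ : ℝ → ℝ)
    (a b' : ℝ) (u : ℝ → Pt d → ℝ) (v₁ : ℝ → Pt d → Pt d) (v₂ : ℝ → Pt d → ℝ) : Prop where
  density : IsDensityFamily b u
  transport : IsSmoothFamily b v₁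
  reaction : IsSmoothFamily b v₂
  equation : ∀ s ∈ Icc a b', ∀ x, HasDerivAt (fun r => u r x)
    (-divergence (fun y => V₁ (u s y) • v₁ s y) x + v₂ s x * V₂ (u s x)) s

/-- The control objective
`∫_a^{b'} [ ∫_Ω ½ ‖v₁‖² V₁(u) + ½ |v₂|² V₂(u) dx - F(u) ] dt`. -/
def action {d : ℕ} (b : Module.Basis (Fin d) ℝ (Pt d)) (V₁ V₂ : ℝ → ℝ) (F : (Pt d → ℝ) → ℝ)
    (a b' : ℝ) (u : ℝ → Pt d → ℝ) (v₁ : ℝ → Pt d → Pt d) (v₂ : ℝ → Pt d → ℝ) : ℝ :=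
  ∫ s in a..b',
    ((∫ x in parallelepiped b,
        ((1 / 2) * ‖v₁ s x‖ ^ 2 * V₁ (u s x) + (1 / 2) * |v₂ s x| ^ 2 * V₂ (u s x)))
      - F (u s))

/-- The value functional `𝒰(t, w)` of the mean-field control problem on `[0, t]` with terminal
density `u_t = w` and initial density `u_0 ∈ D`, at an initial cost `ψ(u_0)`. The problem with a
prescribed initial density `μ` is the case `D = {μ}`, `ψ = 0`. -/
def valueFunctional {d : ℕ} (b : Module.Basis (Fin d) ℝ (Pt d)) (V₁ V₂ : ℝ → ℝ)
    (F : (Pt d → ℝ) → ℝ) (D : Set (Pt d → ℝ)) (ψ : (Pt d → ℝ) → ℝ)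
    (t : ℝ) (w : Pt d → ℝ) : EReal :=
  sInf {A : EReal | ∃ u v₁ v₂, IsControlledPath b V₁ V₂ 0 t u v₁ v₂ ∧ u 0 ∈ D ∧ u t = w ∧
    A = ((ψ (u 0) + action b V₁ V₂ F 0 t u v₁ v₂ : ℝ) : EReal)}

/-- `(u, v₁, v₂)` is a minimizer of the control problem that defines `𝒰(t, u_t)`. -/
def IsMinimizer {d : ℕ} (b : Module.Basis (Fin d) ℝ (Pt d)) (V₁ V₂ : ℝ → ℝ)
    (F : (Pt d → ℝ) → ℝ) (D : Set (Pt d → ℝ)) (ψ : (Pt d → ℝ) → ℝ)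
    (t : ℝ) (u : ℝ → Pt d → ℝ) (v₁ : ℝ → Pt d → Pt d) (v₂ : ℝ → Pt d → ℝ) : Prop :=
  IsControlledPath b V₁ V₂ 0 t u v₁ v₂ ∧ u 0 ∈ D ∧
    valueFunctional b V₁ V₂ F D ψ t (u t) =
      ((ψ (u 0) + action b V₁ V₂ F 0 t u v₁ v₂ : ℝ) : EReal)

/-- The Hamiltonian `H(u, Φ) = ∫_Ω (½ ‖∇Φ‖² V₁(u) + ½ |Φ|² V₂(u)) dx + F(u)`. -/
def hamiltonian {d : ℕ} (b : Module.Basis (Fin d) ℝ (Pt d)) (V₁ V₂ : ℝ → ℝ)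
    (F : (Pt d → ℝ) → ℝ) (u Φ : Pt d → ℝ) : ℝ :=
  (∫ x in parallelepiped b,
    ((1 / 2) * ‖gradient Φ x‖ ^ 2 * V₁ (u x) + (1 / 2) * |Φ x| ^ 2 * V₂ (u x))) + F u

/-- The left-hand side of the functional Hamilton–Jacobi equation at a density `w`, with
`τ = ∂_t 𝒰(t, w)` and `Φ = δ𝒰/δu (t, w)`. -/
def hamiltonJacobi {d : ℕ} (b : Module.Basis (Fin d) ℝ (Pt d)) (V₁ V₂ : ℝ → ℝ)
    (F : (Pt d → ℝ) → ℝ) (w : Pt d → ℝ) (τ : ℝ) (Φ : Pt d → ℝ) : ℝ :=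
  τ + (1 / 2) * (∫ x in parallelepiped b, ‖gradient Φ x‖ ^ 2 * V₁ (w x))
    + (1 / 2) * (∫ x in parallelepiped b, |Φ x| ^ 2 * V₂ (w x)) + F w

/-- The velocity `-∇ · (V₁(u) ∇Φ) + V₂(u) Φ` of the density. -/
def densityVelocity {d : ℕ} (V₁ V₂ : ℝ → ℝ) (u Φ : Pt d → ℝ) (x : Pt d) : ℝ :=
  -divergence (fun y => V₁ (u y) • gradient Φ y) x + V₂ (u x) * Φ x

/-- The expression `½ ‖∇Φ‖² V₁'(u) + ½ |Φ|² V₂'(u) + δF/δu`. -/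
def momentumForce {d : ℕ} (V₁ V₂ : ℝ → ℝ) (dF : (Pt d → ℝ) → Pt d → ℝ) (u Φ : Pt d → ℝ)
    (x : Pt d) : ℝ :=
  (1 / 2) * ‖gradient Φ x‖ ^ 2 * deriv V₁ (u x) + (1 / 2) * |Φ x| ^ 2 * deriv V₂ (u x) + dF u x

/-- The mean-field Hamiltonian flow for the times in `I`:
`∂_t u + ∇ · (V₁(u) ∇Φ) = V₂(u) Φ` and
`∂_t Φ + ½ ‖∇Φ‖² V₁'(u) + ½ |Φ|² V₂'(u) + δF/δu (u) = 0`. -/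
def IsHamiltonianFlow {d : ℕ} (V₁ V₂ : ℝ → ℝ) (dF : (Pt d → ℝ) → Pt d → ℝ) (I : Set ℝ)
    (u Φ : ℝ → Pt d → ℝ) : Prop :=
  ∀ s ∈ I, ∀ x,
    HasDerivAt (fun r => u r x) (densityVelocity V₁ V₂ (u s) (Φ s) x) s ∧
    HasDerivAt (fun r => Φ r x) (-momentumForce V₁ V₂ dF (u s) (Φ s) x) s

end

end MeanField

open MeanField

/-! The heart of the matter is dynamic programming combined with completion of a square. If `w`
moves by the controlled equation, integration by parts on the periodic cell shows that the power `∫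
Φ ∂_s w` equals `E(v) + E(∇Φ, Φ) - E(v₁ - ∇Φ, v₂ - Φ)`, with `E` the kinetic energy at `w`
(`integral_mul_velocity`). The value functional grows along any controlled path at most by the
action (`valueFunctional_le_add_action`), and exactly by the action along a minimizer
(`IsMinimizer.valueFunctional_eq`). A left derivative at the final time of a path driven by `Φ`
shows that the left side of (HJ) is at most zero; along the minimizer it shows that this side is at
least `E(v₁ - ∇Φ, v₂ - Φ)`. Hence both vanish, which gives (HJ) and identifies the controls wherever
the mobilities do not vanish (`IsMinimizer.hamiltonJacobi`).

Admissible paths are smooth, so two of them cannot simply be concatenated. Each is slowed to rest at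
the junction; the additional action tends to zero as the slow interval shrinks
(`IsControlledPath.exists_glue_action_lt`).

The momentum equation is an envelope argument. The curve `u` is perturbed to `p = u + sin e · h`
with `h` constant in time on `[s, s']`, so that `p` has the same velocity and can be driven by the
same fluxes, with controls `V(u)/V(p) · v`. Then `𝒰(s, p_s) + action - 𝒰(s', p_{s'})` is nonnegative
and vanishes at `e = 0`, so its derivative there is zero. At fixed flux the kinetic energy is a flux
squared divided by `2 V(p)`, whence the terms `-½ |v|² V'(u)`. The fundamental lemma of the calculus
of variations gives an integral identity for `Φ` at every point, which is then differentiated in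
time (`hasDerivAt_momentum`). No second variation of `𝒰` enters, and the time derivative of `Φ` is a
conclusion.

For a classical solution `𝒲`, (HJ) and the same square give the growth inequality along all
competing paths, and equality along the given curve, so the same momentum lemma applies. Hamilton's
form of the flow is differentiation under the integral and integration by parts. -/

namespace MeanField

/-! ### Periodic functions and their integrals over the cell -/

section Cell

open scoped Pointwise

variable {d : ℕ} {b : Module.Basis (Fin d) ℝ (Pt d)}

theorem isCompact_cell (b : Module.Basis (Fin d) ℝ (Pt d)) : IsCompact (parallelepiped b) := by
  have := b.parallelepiped.isCompact
  rwa [Module.Basis.coe_parallelepiped] at this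

theorem periodic_of_mem_lattice {X : Type*} {f : Pt d → X} (hf : ∀ x i, f (x + b i) = f x)
    {v : Pt d} (hv : v ∈ Submodule.span ℤ (range b)) : Function.Periodic f v := by
  induction hv using Submodule.span_induction with
  | mem v hv =>
    obtain ⟨i, rfl⟩ := hv
    exact fun x => hf x i
  | zero => intro x; simp
  | add v w _ _ hv hw => exact hv.add_period hw
  | smul n v _ hv => exact hv.zsmul n

/-- A lattice translation takes each point to its fractional part in the fundamental domain.
Compactness of the cell thereby yields bounds on all of `ℝ^d`. -/
theorem exists_mem_cell_eq {X : Type*} {f : Pt d → X} (hf : ∀ x i, f (x + b i) = f x) (x : Pt d) :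
    ∃ y ∈ parallelepiped b, f y = f x := by
  refine ⟨ZSpan.fract b x, ZSpan.fundamentalDomain_subset_parallelepiped b
    (ZSpan.fract_mem_fundamentalDomain b x), ?_⟩
  have := periodic_of_mem_lattice hf (ZSpan.floor b x).2 (ZSpan.fract b x)
  rw [← this, ZSpan.fract_apply, sub_add_cancel]

theorem exists_pos_forall_le_of_periodic {G : ℝ → Pt d → ℝ}
    (hG : Continuous fun q : ℝ × Pt d => G q.1 q.2)
    (hper : ∀ s x i, G s (x + b i) = G s x) (hpos : ∀ s x, 0 < G s x) {K : Set ℝ}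
    (hK : IsCompact K) : ∃ δ > 0, ∀ s ∈ K, ∀ x, δ ≤ G s x := by
  obtain ⟨δ, hδ, h⟩ := (hK.prod (isCompact_cell b)).exists_forall_le' hG.continuousOn
    (a := 0) (fun q _ => hpos q.1 q.2)
  refine ⟨δ, hδ, fun s hs x => ?_⟩
  obtain ⟨y, hy, hyx⟩ := exists_mem_cell_eq (hper s) x
  exact hyx ▸ h (s, y) ⟨hs, hy⟩

theorem exists_forall_abs_le_of_periodic {f : Pt d → ℝ} (hf : Continuous f)
    (hper : ∀ x i, f (x + b i) = f x) : ∃ C > 0, ∀ x, |f x| ≤ C := by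
  obtain ⟨C, h⟩ := (isCompact_cell b).exists_bound_of_continuousOn hf.continuousOn
  refine ⟨max C 1, by positivity, fun x => ?_⟩
  obtain ⟨y, hy, hyx⟩ := exists_mem_cell_eq hper x
  exact hyx ▸ (h y hy).trans (le_max_left _ _)

theorem vaddInvariantMeasure_lattice (b : Module.Basis (Fin d) ℝ (Pt d)) :
    VAddInvariantMeasure (Submodule.span ℤ (range b)) (Pt d) volume :=
  ⟨fun c s _ => measure_preimage_add volume (c : Pt d) s⟩

/-- The cell is a fundamental domain of the lattice up to a null set, its translate is another one,
and lattice-invariant functions have the same integral over both. This invariance is what makes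
boundary terms disappear. -/
theorem integral_cell_add {f : Pt d → ℝ} (hper : ∀ x i, f (x + b i) = f x) (v : Pt d) :
    ∫ x in parallelepiped b, f (x + v) = ∫ x in parallelepiped b, f x := by
  have hae := ZSpan.fundamentalDomain_ae_parallelepiped b (volume : Measure (Pt d))
  rw [← setIntegral_congr_set hae, ← setIntegral_congr_set hae]
  have h1 := ZSpan.isAddFundamentalDomain b (volume : Measure (Pt d))
  have h2 := h1.vadd_of_comm (G' := Pt d) v
  have hcou : Countable (Submodule.span ℤ (range b)) := by infer_instance
  have hinv := vaddInvariantMeasure_lattice b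
  have h3 := h2.setIntegral_eq h1 (f := f) (fun g x => by
    rw [Submodule.vadd_def, vadd_eq_add, add_comm]
    exact periodic_of_mem_lattice hper g.2 x)
  rw [← h3]
  have := (measurePreserving_vadd v (volume : Measure (Pt d))).setIntegral_image_emb
    (measurableEmbedding_const_vadd v) f (ZSpan.fundamentalDomain b)
  rw [show v +ᵥ ZSpan.fundamentalDomain b = (fun x => v +ᵥ x) '' ZSpan.fundamentalDomain b from rfl,
    this]
  simp only [vadd_eq_add, add_comm]

/-- The set `{f ≠ 0}` is lattice-invariant and null in a fundamental domain, hence null; a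
continuous function that vanishes almost everywhere vanishes. -/
theorem eq_zero_of_ae_cell_eq_zero {f : Pt d → ℝ} (hf : Continuous f)
    (hper : ∀ x i, f (x + b i) = f x) (h : ∀ᵐ x ∂volume.restrict (parallelepiped b), f x = 0) :
    f = 0 := by
  have hae := ZSpan.fundamentalDomain_ae_parallelepiped b (volume : Measure (Pt d))
  have h1 := ZSpan.isAddFundamentalDomain b (volume : Measure (Pt d))
  rw [← Measure.restrict_congr_set hae, ae_restrict_iff'₀ h1.nullMeasurableSet] at h
  have hcou : Countable (Submodule.span ℤ (range b)) := by infer_instance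
  have hinv := vaddInvariantMeasure_lattice b
  have h2 : volume {x | f x ≠ 0} = 0 := by
    refine h1.measure_zero_of_invariant _ (fun g => ?_) ?_
    · ext x
      rw [mem_vadd_set_iff_neg_vadd_mem, mem_ofPred_eq, mem_ofPred_eq, Submodule.vadd_def,
        vadd_eq_add, add_comm, periodic_of_mem_lattice hper (-g).2 x]
    · rw [← h]
      congr 1
      ext x
      simp [and_comm]
  refine (Continuous.ae_eq_iff_eq volume hf continuous_zero).1 ?_
  exact h2

theorem eq_zero_of_integral_cell_eq_zero {f : Pt d → ℝ} (hf : Continuous f)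
    (hper : ∀ x i, f (x + b i) = f x) (h0 : ∀ x, 0 ≤ f x) (h : ∫ x in parallelepiped b, f x = 0) :
    f = 0 := by
  refine eq_zero_of_ae_cell_eq_zero hf hper ?_
  exact (integral_eq_zero_iff_of_nonneg h0
    (hf.continuousOn.integrableOn_compact (isCompact_cell b))).1 h

theorem integrableOn_cell {f : Pt d → ℝ} (hf : Continuous f) :
    IntegrableOn f (parallelepiped b) :=
  hf.continuousOn.integrableOn_compact (isCompact_cell b)

end Cell

/-- On the compact set `[s - 1, s + 1] × K` the continuous derivative is bounded, and this constant
is the dominating function. -/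
theorem hasDerivAt_setIntegral {Y : Type*} [TopologicalSpace Y] [MeasurableSpace Y]
    [OpensMeasurableSpace Y] [SecondCountableTopology Y] {μ : Measure Y}
    [IsLocallyFiniteMeasure μ] {K : Set Y} (hK : IsCompact K) (hKm : MeasurableSet K)
    {G G' : ℝ → Y → ℝ} (hG : ∀ s, ContinuousOn (G s) K)
    (hG' : ContinuousOn (fun q : ℝ × Y => G' q.1 q.2) (univ ×ˢ K))
    (h : ∀ s, ∀ y ∈ K, HasDerivAt (fun r => G r y) (G' s y) s) (s : ℝ) :
    HasDerivAt (fun r => ∫ y in K, G r y ∂μ) (∫ y in K, G' s y ∂μ) s := by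
  have hK' : IsCompact (Icc (s - 1) (s + 1) ×ˢ K) := isCompact_Icc.prod hK
  obtain ⟨C, hC⟩ := hK'.exists_bound_of_continuousOn
    (hG'.mono (prod_mono (subset_univ _) subset_rfl))
  have hs : Icc (s - 1) (s + 1) ∈ 𝓝 s := Icc_mem_nhds (by linarith) (by linarith)
  have hG's : ContinuousOn (G' s) K := hG'.comp (f := fun y => (s, y)) (by fun_prop)
    (fun y hy => ⟨mem_univ _, hy⟩)
  refine (hasDerivAt_integral_of_dominated_loc_of_deriv_le (bound := fun _ => C) hs
    (Eventually.of_forall fun r => (hG r).aestronglyMeasurable hKm) ?_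
    (hG's.aestronglyMeasurable hKm) ?_ ?_ ?_).2
  · obtain ⟨D, hD⟩ := hK.exists_bound_of_continuousOn (hG s)
    exact IntegrableOn.of_bound hK.measure_lt_top ((hG s).aestronglyMeasurable hKm) D
      ((ae_restrict_iff' hKm).2 (Eventually.of_forall hD))
  · exact (ae_restrict_iff' hKm).2 (Eventually.of_forall fun y hy r hr => hC (r, y) ⟨hr, hy⟩)
  · exact integrableOn_const hK.measure_ne_top
  · exact (ae_restrict_iff' hKm).2 (Eventually.of_forall fun y hy r _ => h r y hy)

/-! ### Vector calculus, integration by parts and the fundamental lemma -/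

section Calculus

variable {d : ℕ} {b : Module.Basis (Fin d) ℝ (Pt d)}

theorem measurableSet_cell (b : Module.Basis (Fin d) ℝ (Pt d)) :
    MeasurableSet (parallelepiped b) := (isCompact_cell b).isClosed.measurableSet

theorem continuous_integral_cell {P : Type*} [TopologicalSpace P] [FirstCountableTopology P]
    [LocallyCompactSpace P] {G : P → Pt d → ℝ}
    (hG : Continuous fun q : P × Pt d => G q.1 q.2) :
    Continuous fun s => ∫ x in parallelepiped b, G s x :=
  continuous_parametric_integral_of_continuous hG (isCompact_cell b)

/-- The integral of `f (x + r • v)` over the cell does not depend on `r`; its derivative at `r = 0`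
is the integral in question. -/
theorem integral_cell_fderiv {f : Pt d → ℝ} (hf : ContDiff ℝ 1 f)
    (hper : ∀ x i, f (x + b i) = f x) (v : Pt d) :
    ∫ x in parallelepiped b, fderiv ℝ f x v = 0 := by
  have hf' : Continuous (fderiv ℝ f) := hf.continuous_fderiv one_ne_zero
  have h := hasDerivAt_setIntegral (μ := volume) (isCompact_cell b) (measurableSet_cell b)
    (G := fun r x => f (x + r • v)) (G' := fun r x => fderiv ℝ f (x + r • v) v)
    (fun s => (hf.continuous.comp (by fun_prop)).continuousOn)
    (by fun_prop)
    (fun s x _ => by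
      have h1 : HasDerivAt (fun r : ℝ => x + r • v) v s := by
        simpa using ((hasDerivAt_id s).smul_const v).const_add x
      exact ((hf.differentiable one_ne_zero _).hasFDerivAt).comp_hasDerivAt s h1) 0
  simp only [integral_cell_add hper, zero_smul, add_zero] at h
  exact h.unique (hasDerivAt_const _ _)

theorem fderiv_eq_inner_gradient {Φ : Pt d → ℝ} (x v : Pt d) :
    fderiv ℝ Φ x v = inner ℝ (gradient Φ x) v := by
  rw [gradient, InnerProductSpace.toDual_symm_apply]

theorem IsSmoothPeriodic.contDiff_gradient {Φ : Pt d → ℝ} (hΦ : IsSmoothPeriodic b Φ) :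
    ContDiff ℝ ∞ (gradient Φ) := by
  have h : ContDiff ℝ ∞ (fderiv ℝ Φ) := hΦ.1.fderiv_right (by simp)
  exact (InnerProductSpace.toDual ℝ (Pt d)).symm.contDiff.comp h

theorem gradient_periodic {Φ : Pt d → ℝ} (hΦ : ∀ x i, Φ (x + b i) = Φ x) (x : Pt d) (i : Fin d) :
    gradient Φ (x + b i) = gradient Φ x := by
  have : (fun y => Φ (y + b i)) = Φ := funext fun y => hΦ y i
  rw [gradient, gradient, ← fderiv_comp_add_right, this]

theorem divergence_smul {Φ : Pt d → ℝ} {m : Pt d → Pt d} (hΦ : Differentiable ℝ Φ)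
    (hm : Differentiable ℝ m) (x : Pt d) :
    divergence (fun y => Φ y • m y) x = Φ x * divergence m x + inner ℝ (gradient Φ x) (m x) := by
  have hmi : ∀ i, DifferentiableAt ℝ (fun y => m y i) x := fun i => by fun_prop
  have h1 : ∀ i, fderiv ℝ (fun y => (Φ y • m y) i) x (EuclideanSpace.single i 1)
      = Φ x * fderiv ℝ (fun y => m y i) x (EuclideanSpace.single i 1)
        + m x i * fderiv ℝ Φ x (EuclideanSpace.single i 1) := fun i => by
    simp only [PiLp.smul_apply, smul_eq_mul]
    rw [fderiv_fun_mul (hΦ x) (hmi i)]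
    simp
  simp only [divergence, h1, Finset.sum_add_distrib, ← Finset.mul_sum]
  congr 1
  rw [← fderiv_eq_inner_gradient]
  conv_rhs => rw [← (EuclideanSpace.basisFun (Fin d) ℝ).sum_repr (m x)]
  simp [map_sum]

theorem contDiff_divergence {m : Pt d → Pt d} (hm : ContDiff ℝ ∞ m) :
    ContDiff ℝ ∞ (divergence m) := by
  unfold divergence
  refine ContDiff.sum fun i _ => ?_
  have h : ContDiff ℝ ∞ (fun y => m y i) := by fun_prop
  have h' : ContDiff ℝ ∞ (fderiv ℝ fun y => m y i) := h.fderiv_right (by simp)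
  fun_prop

theorem divergence_periodic {m : Pt d → Pt d} (hm : ∀ x i, m (x + b i) = m x)
    (x : Pt d) (i : Fin d) : divergence m (x + b i) = divergence m x := by
  have : (fun y => m (y + b i)) = m := funext fun y => hm y i
  unfold divergence
  refine Finset.sum_congr rfl fun j _ => ?_
  rw [← fderiv_comp_add_right]
  simp only [hm]

theorem integral_cell_divergence {m : Pt d → Pt d} (hm : ContDiff ℝ ∞ m)
    (hper : ∀ x i, m (x + b i) = m x) : ∫ x in parallelepiped b, divergence m x = 0 := by
  have h : ∀ i, ContDiff ℝ ∞ (fun y => m y i) := fun i => by fun_prop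
  unfold divergence
  rw [integral_finsetSum]
  · exact Finset.sum_eq_zero fun i _ => integral_cell_fderiv ((h i).of_le (by simp))
      (fun x j => by rw [hper]) _
  · intro i _
    have h' : ContDiff ℝ ∞ (fderiv ℝ fun y => m y i) := (h i).fderiv_right (by simp)
    exact integrableOn_cell (h'.continuous.clm_apply continuous_const)

theorem integral_mul_divergence {Φ : Pt d → ℝ} {m : Pt d → Pt d} (hΦ : IsSmoothPeriodic b Φ)
    (hm : ContDiff ℝ ∞ m) (hper : ∀ x i, m (x + b i) = m x) :
    ∫ x in parallelepiped b, Φ x * divergence m x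
      = -∫ x in parallelepiped b, inner ℝ (gradient Φ x) (m x) := by
  have h := integral_cell_divergence (b := b) (m := fun y => Φ y • m y) (hΦ.1.smul hm)
    (fun x i => by rw [hΦ.2, hper])
  have hdiff : Differentiable ℝ Φ := hΦ.1.differentiable (by simp)
  simp only [divergence_smul hdiff (hm.differentiable (by simp))] at h
  rw [integral_add] at h
  · linarith
  · exact integrableOn_cell (hΦ.1.continuous.mul (contDiff_divergence hm).continuous)
  · exact integrableOn_cell (hΦ.contDiff_gradient.continuous.inner hm.continuous)

/-- The fundamental lemma of the calculus of variations for periodic test functions. -/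
theorem eq_zero_of_forall_integral_mul_eq_zero {f : Pt d → ℝ} (hf : Continuous f)
    (hper : ∀ x i, f (x + b i) = f x)
    (h : ∀ k, IsSmoothPeriodic b k → ∫ x in parallelepiped b, f x * k x = 0) : f = 0 := by
  have hi : ∀ {g : Pt d → ℝ}, Continuous g → IntegrableOn g (parallelepiped b) :=
    fun hg => integrableOn_cell hg
  -- A mollification `k` of `f` is an admissible test function within `ε` of `f` on the cell, and `∫
  -- f k = 0` turns `∫ f²` into `∫ f (f - k)`.
  have key : ∀ ε > 0, ∫ x in parallelepiped b, f x * f x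
      ≤ ε * ∫ x in parallelepiped b, |f x| := by
    intro ε hε
    -- Only one of the two compared points has to lie in the cell: the mollifier sees values outside
    -- it.
    have huc := (isCompact_cell b).uniformContinuousAt_of_continuousAt f
      (fun a _ => hf.continuousAt) (Metric.dist_mem_uniformity hε)
    obtain ⟨δ, hδ, hδ'⟩ := Metric.mem_uniformity_dist.1 huc
    let φ : ContDiffBump (0 : Pt d) := ⟨δ / 2, δ, by positivity, by linarith⟩
    let k : Pt d → ℝ := convolution (φ.normed volume) f (ContinuousLinearMap.lsmul ℝ ℝ) volume
    have hk : IsSmoothPeriodic b k := by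
      refine ⟨φ.hasCompactSupport_normed.contDiff_convolution_left _ φ.contDiff_normed
        hf.locallyIntegrable, fun x i => ?_⟩
      simp only [k, convolution]
      refine integral_congr_ae (Eventually.of_forall fun y => ?_)
      simp only
      rw [add_sub_right_comm, hper]
    have hkf : ∀ x ∈ parallelepiped b, |k x - f x| ≤ ε := fun x hx =>
      φ.dist_normed_convolution_le hf.aestronglyMeasurable fun y hy => by
        have := hδ' (a := x) (b := y) (by rwa [dist_comm]) hx
        rw [dist_comm]
        exact this.le
    have hkc := hk.1.continuous
    have h1 : ∫ x in parallelepiped b, f x * f x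
        = ∫ x in parallelepiped b, f x * (f x - k x) := by
      simp only [mul_sub]
      rw [integral_sub (f := fun x => f x * f x) (g := fun x => f x * k x) (hi (hf.mul hf))
        (hi (hf.mul hkc)), h k hk, sub_zero]
    rw [h1, ← integral_const_mul]
    refine setIntegral_mono_on (hi (by fun_prop)) (hi (by fun_prop)) (measurableSet_cell b)
      fun x hx => ?_
    calc f x * (f x - k x) ≤ |f x * (f x - k x)| := le_abs_self _
      _ = |f x| * |k x - f x| := by rw [abs_mul, abs_sub_comm (f x)]
      _ ≤ |f x| * ε := by gcongr; exact hkf x hx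
      _ = ε * |f x| := mul_comm _ _
  have h0 : ∫ x in parallelepiped b, f x * f x = 0 := by
    refine le_antisymm ?_ (integral_nonneg fun x => mul_self_nonneg _)
    have hlim : Tendsto (fun ε : ℝ => ε * ∫ x in parallelepiped b, |f x|) (𝓝[>] 0) (𝓝 0) := by
      have : Tendsto (fun ε : ℝ => ε * ∫ x in parallelepiped b, |f x|) (𝓝 0) (𝓝 (0 * _)) :=
        tendsto_id.mul_const _
      rw [zero_mul] at this
      exact this.mono_left nhdsWithin_le_nhds
    exact ge_of_tendsto hlim (eventually_mem_nhdsWithin.mono fun ε hε => key ε hε)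
  have := eq_zero_of_integral_cell_eq_zero (hf.mul hf) (fun x i => by simp [hper])
    (fun x => mul_self_nonneg _) h0
  ext x
  exact mul_self_eq_zero.1 (congrFun this x)

end Calculus

/-! ### Changes of time that start from rest -/

section Reparametrization

theorem contDiff_deriv_smoothTransition : ContDiff ℝ ∞ (deriv Real.smoothTransition) :=
  (contDiff_infty_iff_deriv.1 Real.smoothTransition.contDiff).2

/-- A smooth change of time which is constant on `(-∞, 0]` and is the identity on `[1 / n, ∞)`. -/
noncomputable def slowStart (n : ℕ) (x : ℝ) : ℝ := x * Real.smoothTransition (n * x)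

/-- The speed of `slowStart`. -/
noncomputable def slowSpeed (n : ℕ) (x : ℝ) : ℝ :=
  Real.smoothTransition (n * x) + n * x * deriv Real.smoothTransition (n * x)

theorem contDiff_slowStart (n : ℕ) : ContDiff ℝ ∞ (slowStart n) :=
  contDiff_id.mul (Real.smoothTransition.contDiff.comp (contDiff_const.mul contDiff_id))

theorem contDiff_slowSpeed (n : ℕ) : ContDiff ℝ ∞ (slowSpeed n) := by
  have h : ContDiff ℝ ∞ fun x : ℝ => (n : ℝ) * x := contDiff_const.mul contDiff_id
  exact (Real.smoothTransition.contDiff.comp h).add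
    (h.mul (contDiff_deriv_smoothTransition.comp h))

theorem hasDerivAt_slowStart (n : ℕ) (x : ℝ) : HasDerivAt (slowStart n) (slowSpeed n x) x := by
  have hT : HasDerivAt Real.smoothTransition (deriv Real.smoothTransition (n * x)) (n * x) :=
    (Real.smoothTransition.contDiff (n := 1)).differentiable one_ne_zero _ |>.hasDerivAt
  have h := (hasDerivAt_id x).mul (hT.comp x ((hasDerivAt_id x).const_mul (n : ℝ)))
  refine h.congr_deriv ?_
  simp [slowSpeed]
  ring

theorem slowStart_of_nonpos (n : ℕ) {x : ℝ} (hx : x ≤ 0) : slowStart n x = 0 := by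
  rw [slowStart, Real.smoothTransition.zero_of_nonpos
    (mul_nonpos_of_nonneg_of_nonpos n.cast_nonneg hx), mul_zero]

theorem slowSpeed_of_nonpos (n : ℕ) {x : ℝ} (hx : x ≤ 0) : slowSpeed n x = 0 := by
  -- The one-sided derivative covers `x = 0`, where `slowStart n` is constant only to the left.
  have h : HasDerivWithinAt (slowStart n) 0 (Iic x) x :=
    (hasDerivWithinAt_const x _ (0 : ℝ)).congr (fun y hy => slowStart_of_nonpos n (le_trans hy hx))
      (slowStart_of_nonpos n hx)
  exact (uniqueDiffOn_Iic x).uniqueDiffWithinAt self_mem_Iic |>.eq_deriv _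
    (hasDerivAt_slowStart n x).hasDerivWithinAt h

theorem slowStart_of_one_le {n : ℕ} {x : ℝ} (hx : 1 ≤ n * x) : slowStart n x = x := by
  rw [slowStart, Real.smoothTransition.one_of_one_le hx, mul_one]

theorem deriv_smoothTransition_of_one_lt {y : ℝ} (hy : 1 < y) :
    deriv Real.smoothTransition y = 0 := by
  have : Real.smoothTransition =ᶠ[𝓝 y] fun _ => 1 :=
    (eventually_gt_nhds hy).mono fun z hz => Real.smoothTransition.one_of_one_le hz.le
  rw [this.deriv_eq, deriv_const]

theorem slowSpeed_of_one_lt {n : ℕ} {x : ℝ} (hx : 1 < n * x) : slowSpeed n x = 1 := by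
  rw [slowSpeed, Real.smoothTransition.one_of_one_le hx.le, deriv_smoothTransition_of_one_lt hx]
  simp

theorem slowStart_mem_Icc (n : ℕ) {a x : ℝ} (hx : x ∈ Icc 0 a) : slowStart n x ∈ Icc 0 a :=
  ⟨mul_nonneg hx.1 (Real.smoothTransition.nonneg _),
    (mul_le_of_le_one_right hx.1 (Real.smoothTransition.le_one _)).trans hx.2⟩

/-- The speed is a function of `n * x` alone, continuous on `[0, 1]` and equal to `1` beyond; so the
bound is uniform in `n`. -/
theorem exists_abs_slowSpeed_le : ∃ C, ∀ (n : ℕ) (x : ℝ), 0 ≤ x → |slowSpeed n x| ≤ C := by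
  have hc : Continuous fun y : ℝ => Real.smoothTransition y + y * deriv Real.smoothTransition y :=
    Real.smoothTransition.continuous.add
      (continuous_id.mul contDiff_deriv_smoothTransition.continuous)
  obtain ⟨C, hC⟩ := (isCompact_Icc (a := (0 : ℝ)) (b := 1)).exists_bound_of_continuousOn
    hc.continuousOn
  refine ⟨max C 1, fun n x hx => ?_⟩
  rcases le_or_gt ((n : ℝ) * x) 1 with h | h
  · exact (hC (n * x) ⟨by positivity, h⟩).trans (le_max_left _ _)
  · rw [slowSpeed_of_one_lt h, abs_one]
    exact le_max_right _ _

theorem eventually_one_lt_natCast_mul {x : ℝ} (hx : 0 < x) : ∀ᶠ n : ℕ in atTop, 1 < (n : ℝ) * x :=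
  (tendsto_natCast_atTop_atTop.atTop_mul_const hx).eventually_gt_atTop 1

/-- The squared speed is the factor that a change of time puts on the kinetic energy. Dominated
convergence applies because the speeds are uniformly bounded, and at each `x > 0` the integrand is
unchanged as soon as `1 < n * x`. -/
theorem tendsto_integral_slowStart {E G : ℝ → ℝ} (hE : Continuous E) (hG : Continuous G) {a : ℝ}
    (ha : 0 ≤ a) :
    Tendsto (fun n : ℕ => ∫ x in (0 : ℝ)..a,
        (slowSpeed n x ^ 2 * E (slowStart n x) - G (slowStart n x))) atTop
      (𝓝 (∫ x in (0 : ℝ)..a, (E x - G x))) := by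
  obtain ⟨C, hC⟩ := exists_abs_slowSpeed_le
  obtain ⟨A, hA⟩ := (isCompact_Icc (a := 0) (b := a)).exists_bound_of_continuousOn hE.continuousOn
  obtain ⟨B, hB⟩ := (isCompact_Icc (a := 0) (b := a)).exists_bound_of_continuousOn hG.continuousOn
  refine intervalIntegral.tendsto_integral_filter_of_dominated_convergence
    (fun _ => C ^ 2 * A + B) ?_ ?_ (by simp) ?_
  · refine Eventually.of_forall fun n => Continuous.aestronglyMeasurable ?_
    have h1 := (contDiff_slowSpeed n).continuous
    have h2 := (contDiff_slowStart n).continuous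
    fun_prop
  · refine Eventually.of_forall fun n => Eventually.of_forall fun x hx => ?_
    rw [uIoc_of_le ha] at hx
    have hx' := slowStart_mem_Icc n ⟨hx.1.le, hx.2⟩
    have h1 := hA _ hx'
    have h2 := hB _ hx'
    have h3 : |slowSpeed n x| ^ 2 ≤ C ^ 2 := by gcongr; exact hC n x hx.1.le
    rw [Real.norm_eq_abs] at *
    calc _ ≤ |slowSpeed n x ^ 2 * E (slowStart n x)| + |G (slowStart n x)| := abs_sub _ _
      _ = |slowSpeed n x| ^ 2 * |E (slowStart n x)| + |G (slowStart n x)| := by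
        rw [abs_mul, abs_pow]
      _ ≤ _ := by gcongr
  · refine Eventually.of_forall fun x hx => ?_
    rw [uIoc_of_le ha] at hx
    refine tendsto_const_nhds.congr' ?_
    filter_upwards [eventually_one_lt_natCast_mul hx.1] with n hn
    rw [slowSpeed_of_one_lt hn, slowStart_of_one_le hn.le, one_pow, one_mul]

end Reparametrization

/-! ### Kinetic energy, mobilities and smooth families -/

section Energy

variable {d : ℕ} {b : Module.Basis (Fin d) ℝ (Pt d)} {V V₁ V₂ : ℝ → ℝ}
  {F : (Pt d → ℝ) → ℝ} {dF : (Pt d → ℝ) → Pt d → ℝ}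

/-- The kinetic energy `∫_Ω ½ ‖v₁‖² V₁(u) + ½ |v₂|² V₂(u) dx`. -/
noncomputable def kineticEnergy (b : Module.Basis (Fin d) ℝ (Pt d)) (V₁ V₂ : ℝ → ℝ)
    (u : Pt d → ℝ) (v₁ : Pt d → Pt d) (v₂ : Pt d → ℝ) : ℝ :=
  ∫ x in parallelepiped b, ((1 / 2) * ‖v₁ x‖ ^ 2 * V₁ (u x) + (1 / 2) * |v₂ x| ^ 2 * V₂ (u x))

theorem action_eq {s t : ℝ} {u : ℝ → Pt d → ℝ} {v₁ : ℝ → Pt d → Pt d} {v₂ : ℝ → Pt d → ℝ} :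
    action b V₁ V₂ F s t u v₁ v₂
      = ∫ r in s..t, (kineticEnergy b V₁ V₂ (u r) (v₁ r) (v₂ r) - F (u r)) := rfl

theorem kineticEnergy_smul (a : ℝ) (u : Pt d → ℝ) (v₁ : Pt d → Pt d) (v₂ : Pt d → ℝ) :
    kineticEnergy b V₁ V₂ u (fun x => a • v₁ x) (fun x => a * v₂ x)
      = a ^ 2 * kineticEnergy b V₁ V₂ u v₁ v₂ := by
  rw [kineticEnergy, kineticEnergy, ← integral_const_mul]
  refine integral_congr_ae (Eventually.of_forall fun x => ?_)
  simp only [norm_smul, abs_mul, mul_pow, Real.norm_eq_abs, sq_abs]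
  ring

theorem IsMobility.contDiff_comp (hV : IsMobility V) {E : Type*} [NormedAddCommGroup E]
    [NormedSpace ℝ E] {f : E → ℝ} (hf : ContDiff ℝ ∞ f) (hpos : ∀ x, 0 < f x) :
    ContDiff ℝ ∞ fun x => V (f x) :=
  hV.1.comp_contDiff hf hpos

theorem IsMobility.hasDerivAt (hV : IsMobility V) {r : ℝ} (hr : 0 < r) :
    HasDerivAt V (deriv V r) r :=
  ((hV.1.contDiffAt (Ioi_mem_nhds hr)).differentiableAt (by simp)).hasDerivAt

theorem IsMobility.continuousOn_deriv (hV : IsMobility V) : ContinuousOn (deriv V) (Ioi 0) :=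
  (hV.1.continuousOn_deriv_of_isOpen isOpen_Ioi (by simp))

theorem IsMobility.nonneg (hV : IsMobility V) {r : ℝ} (hr : 0 < r) : 0 ≤ V r := by
  rcases hV.2 with h | h
  · exact (h r hr).le
  · exact (h r hr).ge

/-- Where a mobility vanishes the control is not determined by `Φ`; this lemma removes the
corresponding term from the momentum equation. -/
theorem IsMobility.deriv_eq_zero (hV : IsMobility V) {r : ℝ} (hr : 0 < r) (h0 : V r = 0) :
    deriv V r = 0 := by
  rcases hV.2 with h | h
  · exact absurd h0 (h r hr).ne'
  · have : V =ᶠ[𝓝 r] fun _ => 0 := (eventually_gt_nhds hr).mono fun z hz => h z hz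
    rw [this.deriv_eq, deriv_const]

/-- This is how a flux given at one density is realised at another: the control is multiplied by `V
r / V q`. For the zero mobility the convention `0 / 0 = 0` is harmless, since there is no flux. -/
theorem IsMobility.mul_div (hV : IsMobility V) {r q : ℝ} (hr : 0 < r) (hq : 0 < q) :
    V q * (V r / V q) = V r := by
  rcases hV.2 with h | h
  · exact mul_div_cancel₀ _ (h q hq).ne'
  · rw [h q hq, h r hr, zero_mul]

theorem IsMobility.contDiff_div (hV : IsMobility V) {E : Type*} [NormedAddCommGroup E]
    [NormedSpace ℝ E] {f g : E → ℝ} (hf : ContDiff ℝ ∞ f) (hg : ContDiff ℝ ∞ g)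
    (hfpos : ∀ x, 0 < f x) (hgpos : ∀ x, 0 < g x) :
    ContDiff ℝ ∞ fun x => V (f x) / V (g x) := by
  rcases hV.2 with h | h
  · exact (hV.contDiff_comp hf hfpos).div (hV.contDiff_comp hg hgpos) fun x => (h _ (hgpos x)).ne'
  · simp only [h _ (hfpos _), zero_div]
    exact contDiff_const

theorem continuous_kineticEnergy (hV₁ : IsMobility V₁) (hV₂ : IsMobility V₂)
    {P : Type*} [NormedAddCommGroup P] [NormedSpace ℝ P] [FiniteDimensional ℝ P]
    {u : P → Pt d → ℝ} {v₁ : P → Pt d → Pt d} {v₂ : P → Pt d → ℝ}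
    (hu : IsDensityFamily b u) (hv₁ : Continuous fun q : P × Pt d => v₁ q.1 q.2)
    (hv₂ : Continuous fun q : P × Pt d => v₂ q.1 q.2) :
    Continuous fun r => kineticEnergy b V₁ V₂ (u r) (v₁ r) (v₂ r) := by
  have : ProperSpace P := FiniteDimensional.proper ℝ P
  have h1 := (hV₁.contDiff_comp hu.1.1 fun q => hu.2 q.1 q.2).continuous
  have h2 := (hV₂.contDiff_comp hu.1.1 fun q => hu.2 q.1 q.2).continuous
  exact continuous_integral_cell (((continuous_const.mul (hv₁.norm.pow 2)).mul h1).add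
    ((continuous_const.mul (hv₂.abs.pow 2)).mul h2))

theorem IsDensityFamily.isDensity {P : Type*} [NormedAddCommGroup P] [NormedSpace ℝ P]
    {c : P → Pt d → ℝ} (hc : IsDensityFamily b c) (p : P) : IsDensity b (c p) :=
  ⟨⟨hc.1.1.comp (contDiff_const.prodMk contDiff_id), hc.1.2 p⟩, hc.2 p⟩

theorem IsSmoothFamily.comp {P Q X : Type*} [NormedAddCommGroup P] [NormedSpace ℝ P]
    [NormedAddCommGroup Q] [NormedSpace ℝ Q] [NormedAddCommGroup X] [NormedSpace ℝ X]
    {c : P → Pt d → X} (hc : IsSmoothFamily b c) {f : Q → P} (hf : ContDiff ℝ ∞ f) :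
    IsSmoothFamily b fun q => c (f q) :=
  ⟨hc.1.comp ((hf.comp contDiff_fst).prodMk contDiff_snd), fun q => hc.2 (f q)⟩

theorem IsDensityFamily.comp {P Q : Type*} [NormedAddCommGroup P] [NormedSpace ℝ P]
    [NormedAddCommGroup Q] [NormedSpace ℝ Q]
    {c : P → Pt d → ℝ} (hc : IsDensityFamily b c) {f : Q → P} (hf : ContDiff ℝ ∞ f) :
    IsDensityFamily b fun q => c (f q) :=
  ⟨hc.1.comp hf, fun q => hc.2 (f q)⟩

theorem IsSmoothFamily.hasDerivAt {X : Type*} [NormedAddCommGroup X] [NormedSpace ℝ X]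
    {c : ℝ → Pt d → X} (hc : IsSmoothFamily b c) (s : ℝ) (x : Pt d) :
    HasDerivAt (fun r => c r x) (deriv (fun r => c r x) s) s := by
  have h : ContDiff ℝ ∞ fun r => c r x := hc.1.comp (contDiff_id.prodMk contDiff_const)
  exact (h.differentiable (by simp) s).hasDerivAt

theorem IsEnergy.hasDerivAt (hF : IsEnergy b F dF) {c : ℝ → Pt d → ℝ} (hc : IsDensityFamily b c)
    (s : ℝ) : HasDerivAt (fun r => F (c r))
      (∫ x in parallelepiped b, dF (c s) x * deriv (fun r => c r x) s) s := by
  have h := hF.variation (c s) (hc.isDensity s) (fun r => c (s + r))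
    (hc.comp (contDiff_const.add contDiff_id)) (by simp)
  have h' : HasDerivAt (fun r => F (c r))
      (∫ x in parallelepiped b, dF (c s) x * deriv (fun r => c (s + r) x) 0) (s + 0) := by
    have h2 : HasDerivAt (fun r : ℝ => r - s) 1 (s + 0) := (hasDerivAt_id _).sub_const s
    have h3 : HasDerivAt (fun r => F (c (s + r)))
      (∫ x in parallelepiped b, dF (c s) x * deriv (fun r => c (s + r) x) 0) (s + 0 - s) := by
      simpa using h
    simpa [Function.comp_def] using h3.comp (s + 0) h2
  simp only [add_zero] at h'
  refine h'.congr_deriv ?_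
  refine integral_congr_ae (Eventually.of_forall fun x => ?_)
  simp only
  rw [deriv_comp_const_add (f := fun r => c r x), add_zero]

theorem IsEnergy.continuous_comp (hF : IsEnergy b F dF) {c : ℝ → Pt d → ℝ}
    (hc : IsDensityFamily b c) : Continuous fun r => F (c r) :=
  continuous_iff_continuousAt.2 fun s => (hF.hasDerivAt hc s).continuousAt

theorem divergence_const_smul {m : Pt d → Pt d} (a : ℝ) (hm : Differentiable ℝ m) (x : Pt d) :
    divergence (fun y => a • m y) x = a * divergence m x := by
  rw [divergence_smul (differentiable_const a) hm]
  simp [gradient]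

end Energy

/-! ### Gluing of paths and the dynamic programming principle -/

section DynamicProgramming

variable {d : ℕ} {b : Module.Basis (Fin d) ℝ (Pt d)} {V₁ V₂ : ℝ → ℝ}
  {F : (Pt d → ℝ) → ℝ} {dF : (Pt d → ℝ) → Pt d → ℝ}

theorem IsControlledPath.mono {a a' s s' : ℝ} {u : ℝ → Pt d → ℝ} {v₁ : ℝ → Pt d → Pt d}
    {v₂ : ℝ → Pt d → ℝ} (h : IsControlledPath b V₁ V₂ a s u v₁ v₂) (ha : a ≤ a') (hs : s' ≤ s) :
    IsControlledPath b V₁ V₂ a' s' u v₁ v₂ :=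
  ⟨h.density, h.transport, h.reaction, fun r hr => h.equation r ⟨ha.trans hr.1, hr.2.trans hs⟩⟩

theorem IsControlledPath.continuous_lagrangian (hV₁ : IsMobility V₁) (hV₂ : IsMobility V₂)
    (hF : IsEnergy b F dF) {a s : ℝ} {u : ℝ → Pt d → ℝ} {v₁ : ℝ → Pt d → Pt d}
    {v₂ : ℝ → Pt d → ℝ} (h : IsControlledPath b V₁ V₂ a s u v₁ v₂) :
    Continuous fun r => kineticEnergy b V₁ V₂ (u r) (v₁ r) (v₂ r) - F (u r) :=
  (continuous_kineticEnergy hV₁ hV₂ h.density h.transport.1.continuous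
    h.reaction.1.continuous).sub (hF.continuous_comp h.density)

theorem contDiff_slice {X : Type*} [NormedAddCommGroup X] [NormedSpace ℝ X] {c : ℝ → Pt d → X}
    (hc : IsSmoothFamily b c) (s : ℝ) : ContDiff ℝ ∞ (c s) :=
  hc.1.comp (contDiff_const.prodMk contDiff_id)

/-- A smooth path which follows the first of two controlled paths and then the second one, with a
change of time that comes to rest at the junction. -/
theorem IsControlledPath.glue (hV₁ : IsMobility V₁) {s t : ℝ} (h0s : 0 < s)
    (hst : s < t) {u u' : ℝ → Pt d → ℝ} {v₁ v₁' : ℝ → Pt d → Pt d} {v₂ v₂' : ℝ → Pt d → ℝ}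
    (h : IsControlledPath b V₁ V₂ 0 s u v₁ v₂) (h' : IsControlledPath b V₁ V₂ s t u' v₁' v₂')
    (hs : u s = u' s) {n : ℕ} (hn : 1 ≤ n * s) (hn' : 1 ≤ n * (t - s)) :
    ∃ q w₁ w₂, IsControlledPath b V₁ V₂ 0 t q w₁ w₂ ∧ q 0 = u 0 ∧ q t = u' t ∧
      (∀ r ≤ s, q r = u (s - slowStart n (s - r)) ∧
        w₁ r = (fun x => slowSpeed n (s - r) • v₁ (s - slowStart n (s - r)) x) ∧
        w₂ r = (fun x => slowSpeed n (s - r) * v₂ (s - slowStart n (s - r)) x)) ∧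
      (∀ r ≥ s, q r = u' (s + slowStart n (r - s)) ∧
        w₁ r = (fun x => slowSpeed n (r - s) • v₁' (s + slowStart n (r - s)) x) ∧
        w₂ r = (fun x => slowSpeed n (r - s) * v₂' (s + slowStart n (r - s)) x)) := by
  have hη := contDiff_slowStart n
  have hζ := contDiff_slowSpeed n
  let α : ℝ → ℝ := fun r => s - slowStart n (s - r)
  let β : ℝ → ℝ := fun r => s + slowStart n (r - s)
  let α' : ℝ → ℝ := fun r => slowSpeed n (s - r)
  let β' : ℝ → ℝ := fun r => slowSpeed n (r - s)
  have hα : ContDiff ℝ ∞ α := by fun_prop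
  have hβ : ContDiff ℝ ∞ β := by fun_prop
  have hα' : ContDiff ℝ ∞ α' := by fun_prop
  have hβ' : ContDiff ℝ ∞ β' := by fun_prop
  have hdα : ∀ r, HasDerivAt α (α' r) r := fun r => by
    have h1 : HasDerivAt (fun r : ℝ => s - r) (-1) r := (hasDerivAt_id r).const_sub s
    simpa [α, α', Function.comp_def] using
      ((hasDerivAt_slowStart n (s - r)).comp r h1).const_sub s
  have hdβ : ∀ r, HasDerivAt β (β' r) r := fun r => by
    have h1 : HasDerivAt (fun r : ℝ => r - s) 1 r := (hasDerivAt_id r).sub_const s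
    simpa [β, β', Function.comp_def] using
      ((hasDerivAt_slowStart n (r - s)).comp r h1).const_add s
  have hα1 : ∀ r ≥ s, α r = s ∧ α' r = 0 := fun r hr => by
    simp [α, α', slowStart_of_nonpos n (sub_nonpos.2 hr), slowSpeed_of_nonpos n (sub_nonpos.2 hr)]
  have hβ1 : ∀ r ≤ s, β r = s ∧ β' r = 0 := fun r hr => by
    simp [β, β', slowStart_of_nonpos n (sub_nonpos.2 hr), slowSpeed_of_nonpos n (sub_nonpos.2 hr)]
  -- Before the junction `β` rests at `s`, after it `α` does, so two of the three terms always
  -- cancel. The formula is smooth without any matching at `s`; the controls below are likewise sums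
  -- in which the resting half has speed zero.
  let q : ℝ → Pt d → ℝ := fun r x => u (α r) x + u' (β r) x - u s x
  let w₁ : ℝ → Pt d → Pt d := fun r x => α' r • v₁ (α r) x + β' r • v₁' (β r) x
  let w₂ : ℝ → Pt d → ℝ := fun r x => α' r * v₂ (α r) x + β' r * v₂' (β r) x
  have hle : ∀ r ≤ s, q r = u (α r) ∧ w₁ r = (fun x => α' r • v₁ (α r) x) ∧
      w₂ r = fun x => α' r * v₂ (α r) x := fun r hr => by
    refine ⟨?_, ?_, ?_⟩ <;> ext1 x <;> simp [q, w₁, w₂, hβ1 r hr, hs]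
  have hge : ∀ r ≥ s, q r = u' (β r) ∧ w₁ r = (fun x => β' r • v₁' (β r) x) ∧
      w₂ r = fun x => β' r * v₂' (β r) x := fun r hr => by
    refine ⟨?_, ?_, ?_⟩ <;> ext1 x <;> simp [q, w₁, w₂, hα1 r hr]
  have hdq : ∀ r x, HasDerivAt (fun r => q r x)
      (deriv (fun r => u r x) (α r) * α' r + deriv (fun r => u' r x) (β r) * β' r) r :=
    fun r x => (((h.density.1.hasDerivAt (α r) x).comp r (hdα r)).add
      ((h'.density.1.hasDerivAt (β r) x).comp r (hdβ r))).sub_const _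
  refine ⟨q, w₁, w₂, ⟨⟨⟨?_, ?_⟩, ?_⟩, ⟨?_, ?_⟩, ⟨?_, ?_⟩, ?_⟩, ?_, ?_, hle, hge⟩
  · exact ((h.density.1.comp hα).1.add (h'.density.1.comp hβ).1).sub
      (h.density.1.comp (f := fun _ : ℝ => s) contDiff_const).1
  · intro r x i
    simp only [q, h.density.1.2, h'.density.1.2]
  · intro r x
    rcases le_total r s with hr | hr
    · rw [(hle r hr).1]; exact h.density.2 _ _
    · rw [(hge r hr).1]; exact h'.density.2 _ _
  · exact ((hα'.comp contDiff_fst).smul (h.transport.comp hα).1).add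
      ((hβ'.comp contDiff_fst).smul (h'.transport.comp hβ).1)
  · intro r x i
    simp only [w₁, h.transport.2, h'.transport.2]
  · exact ((hα'.comp contDiff_fst).mul (h.reaction.comp hα).1).add
      ((hβ'.comp contDiff_fst).mul (h'.reaction.comp hβ).1)
  · intro r x i
    simp only [w₂, h.reaction.2, h'.reaction.2]
  · intro r hr x
    refine (hdq r x).congr_deriv ?_
    rcases le_total r s with hrs | hrs
    · rw [(hle r hrs).1, (hle r hrs).2.1, (hle r hrs).2.2, (hβ1 r hrs).2]
      have hmem := slowStart_mem_Icc n (a := s) (x := s - r) ⟨by linarith, by linarith [hr.1]⟩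
      have hαm : α r ∈ Icc 0 s := ⟨by simp only [α]; linarith [hmem.2],
        by simp only [α]; linarith [hmem.1]⟩
      rw [(h.equation _ hαm x).deriv]
      simp only [smul_comm (V₁ _) (α' r)]
      rw [divergence_const_smul]
      · ring
      · exact ((hV₁.contDiff_comp (contDiff_slice h.density.1 _) (h.density.2 _)).smul
          (contDiff_slice h.transport _)).differentiable (by simp)
    · rw [(hge r hrs).1, (hge r hrs).2.1, (hge r hrs).2.2, (hα1 r hrs).2]
      have hmem := slowStart_mem_Icc n (a := t - s) (x := r - s)
        ⟨by linarith, by linarith [hr.2]⟩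
      have hβm : β r ∈ Icc s t := ⟨by simp only [β]; linarith [hmem.1],
        by simp only [β]; linarith [hmem.2]⟩
      rw [(h'.equation _ hβm x).deriv]
      simp only [smul_comm (V₁ _) (β' r)]
      rw [divergence_const_smul]
      · ring
      · exact ((hV₁.contDiff_comp (contDiff_slice h'.density.1 _) (h'.density.2 _)).smul
          (contDiff_slice h'.transport _)).differentiable (by simp)
  · rw [(hle 0 h0s.le).1]
    simp [α, slowStart_of_one_le hn]
  · rw [(hge t hst.le).1]
    simp [β, slowStart_of_one_le hn']

/-- The glued path has the two actions with kinetic parts weighted by the squared speed, and these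
converge to the original actions. The loss `ε` is the price of smoothness at the junction. -/
theorem IsControlledPath.exists_glue_action_lt (hV₁ : IsMobility V₁) (hV₂ : IsMobility V₂)
    (hF : IsEnergy b F dF) {s t : ℝ} (h0s : 0 < s)
    (hst : s < t) {u u' : ℝ → Pt d → ℝ} {v₁ v₁' : ℝ → Pt d → Pt d} {v₂ v₂' : ℝ → Pt d → ℝ}
    (h : IsControlledPath b V₁ V₂ 0 s u v₁ v₂) (h' : IsControlledPath b V₁ V₂ s t u' v₁' v₂')
    (hs : u s = u' s) {ε : ℝ} (hε : 0 < ε) :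
    ∃ q w₁ w₂, IsControlledPath b V₁ V₂ 0 t q w₁ w₂ ∧ q 0 = u 0 ∧ q t = u' t ∧
      action b V₁ V₂ F 0 t q w₁ w₂
        < action b V₁ V₂ F 0 s u v₁ v₂ + action b V₁ V₂ F s t u' v₁' v₂' + ε := by
  let E : ℝ → ℝ := fun r => kineticEnergy b V₁ V₂ (u r) (v₁ r) (v₂ r)
  let E' : ℝ → ℝ := fun r => kineticEnergy b V₁ V₂ (u' r) (v₁' r) (v₂' r)
  have hE : Continuous E := continuous_kineticEnergy hV₁ hV₂ h.density h.transport.1.continuous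
    h.reaction.1.continuous
  have hE' : Continuous E' := continuous_kineticEnergy hV₁ hV₂ h'.density
    h'.transport.1.continuous h'.reaction.1.continuous
  have hG := hF.continuous_comp h.density
  have hG' := hF.continuous_comp h'.density
  -- Time is reversed on `[0, s]`, because the first path comes to rest at its end.
  have l1 := tendsto_integral_slowStart (E := fun x => E (s - x)) (G := fun x => F (u (s - x)))
    (by fun_prop) (hG.comp (by fun_prop)) h0s.le
  have l2 := tendsto_integral_slowStart (E := fun x => E' (s + x)) (G := fun x => F (u' (s + x)))
    (by fun_prop) (hG'.comp (by fun_prop)) (sub_pos.2 hst).le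
  have e1 : ∫ x in (0 : ℝ)..s, (E (s - x) - F (u (s - x))) = action b V₁ V₂ F 0 s u v₁ v₂ := by
    rw [intervalIntegral.integral_comp_sub_left (fun y => E y - F (u y)), action_eq]
    simp [E]
  have e2 : ∫ x in (0 : ℝ)..(t - s), (E' (s + x) - F (u' (s + x)))
      = action b V₁ V₂ F s t u' v₁' v₂' := by
    rw [intervalIntegral.integral_comp_add_left (fun y => E' y - F (u' y)), action_eq]
    simp [E']
  rw [e1] at l1
  rw [e2] at l2
  obtain ⟨n, hlt, hn, hn'⟩ := (((l1.add l2).eventually_lt_const (lt_add_of_pos_right _ hε)).and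
    ((eventually_one_lt_natCast_mul h0s).and
      (eventually_one_lt_natCast_mul (sub_pos.2 hst)))).exists
  obtain ⟨q, w₁, w₂, hq, hq0, hqt, hle, hge⟩ := h.glue hV₁ h0s hst h' hs hn.le hn'.le
  refine ⟨q, w₁, w₂, hq, hq0, hqt, lt_of_eq_of_lt ?_ hlt⟩
  have hc := hq.continuous_lagrangian hV₁ hV₂ hF
  rw [action_eq, ← intervalIntegral.integral_add_adjacent_intervals (hc.intervalIntegrable 0 s)
    (hc.intervalIntegrable s t)]
  congr 1
  · have := intervalIntegral.integral_comp_sub_left (a := 0) (b := s)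
      (fun r => kineticEnergy b V₁ V₂ (q r) (w₁ r) (w₂ r) - F (q r)) s
    rw [sub_self, sub_zero] at this
    rw [← this]
    refine intervalIntegral.integral_congr fun x hx => ?_
    rw [uIcc_of_le h0s.le] at hx
    obtain ⟨h1, h2, h3⟩ := hle (s - x) (by linarith [hx.1])
    simp only [h1, h2, h3, kineticEnergy_smul, sub_sub_cancel, E]
  · have := intervalIntegral.integral_comp_add_left (a := 0) (b := t - s)
      (fun r => kineticEnergy b V₁ V₂ (q r) (w₁ r) (w₂ r) - F (q r)) s
    rw [add_sub_cancel, add_zero] at this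
    rw [← this]
    refine intervalIntegral.integral_congr fun x hx => ?_
    rw [uIcc_of_le (sub_pos.2 hst).le] at hx
    obtain ⟨h1, h2, h3⟩ := hge (s + x) (by linarith [hx.1])
    simp only [h1, h2, h3, kineticEnergy_smul, add_sub_cancel_left, E']

variable {D : Set (Pt d → ℝ)} {ψ : (Pt d → ℝ) → ℝ}

theorem valueFunctional_le {t : ℝ} {u : ℝ → Pt d → ℝ} {v₁ : ℝ → Pt d → Pt d}
    {v₂ : ℝ → Pt d → ℝ} (h : IsControlledPath b V₁ V₂ 0 t u v₁ v₂) (h0 : u 0 ∈ D) :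
    valueFunctional b V₁ V₂ F D ψ t (u t)
      ≤ ((ψ (u 0) + action b V₁ V₂ F 0 t u v₁ v₂ : ℝ) : EReal) :=
  sInf_le ⟨u, v₁, v₂, h, h0, rfl, rfl⟩

/-- The dynamic programming inequality. -/
theorem valueFunctional_le_add_action (hV₁ : IsMobility V₁) (hV₂ : IsMobility V₂)
    (hF : IsEnergy b F dF) {s t : ℝ} (h0s : 0 < s) (hst : s < t) {u : ℝ → Pt d → ℝ}
    {v₁ : ℝ → Pt d → Pt d} {v₂ : ℝ → Pt d → ℝ} (h : IsControlledPath b V₁ V₂ s t u v₁ v₂)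
    {g : ℝ} (hg : valueFunctional b V₁ V₂ F D ψ s (u s) = g) :
    valueFunctional b V₁ V₂ F D ψ t (u t)
      ≤ ((g + action b V₁ V₂ F s t u v₁ v₂ : ℝ) : EReal) := by
  by_contra! hlt
  obtain ⟨y, hy1, hy2⟩ := EReal.lt_iff_exists_real_btwn.1 hlt
  rw [EReal.coe_lt_coe_iff] at hy1
  set A := action b V₁ V₂ F s t u v₁ v₂
  -- Half of the gap pays for a nearly optimal path up to time `s`, the other half for the gluing.
  let ε : ℝ := (y - (g + A)) / 2
  have hε : 0 < ε := by simp only [ε]; linarith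
  have hlt' : valueFunctional b V₁ V₂ F D ψ s (u s) < ((g + ε : ℝ) : EReal) := by
    rw [hg, EReal.coe_lt_coe_iff]
    linarith
  obtain ⟨_, ⟨p, w₁, w₂, hp, hp0, hps, rfl⟩, hplt⟩ := sInf_lt_iff.1 hlt'
  rw [EReal.coe_lt_coe_iff] at hplt
  obtain ⟨q, z₁, z₂, hq, hq0, hqt, hqlt⟩ :=
    hp.exists_glue_action_lt hV₁ hV₂ hF h0s hst h hps hε
  have hle := valueFunctional_le (F := F) (ψ := ψ) hq (hq0 ▸ hp0)
  rw [hqt, hq0] at hle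
  have := hy2.trans_le hle
  rw [EReal.coe_lt_coe_iff] at this
  have h2 : y = g + A + 2 * ε := by simp only [ε]; ring
  linarith

/-- The principle of optimality: the restricted path bounds `g` from above, and a smaller `g` would,
by dynamic programming on `[s, t]`, beat the minimizer at time `t`. -/
theorem IsMinimizer.valueFunctional_eq (hV₁ : IsMobility V₁) (hV₂ : IsMobility V₂)
    (hF : IsEnergy b F dF) {s t : ℝ} (hs : s ∈ Ioo 0 t) {u : ℝ → Pt d → ℝ}
    {v₁ : ℝ → Pt d → Pt d} {v₂ : ℝ → Pt d → ℝ} (h : IsMinimizer b V₁ V₂ F D ψ t u v₁ v₂)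
    {g : ℝ} (hg : valueFunctional b V₁ V₂ F D ψ s (u s) = g) :
    g = ψ (u 0) + action b V₁ V₂ F 0 s u v₁ v₂ := by
  have h1 := valueFunctional_le (F := F) (ψ := ψ) (h.1.mono le_rfl hs.2.le) h.2.1
  have h2 := valueFunctional_le_add_action hV₁ hV₂ hF hs.1 hs.2 (h.1.mono hs.1.le le_rfl) hg
  rw [hg, EReal.coe_le_coe_iff] at h1
  rw [h.2.2, EReal.coe_le_coe_iff] at h2
  have hc := h.1.continuous_lagrangian hV₁ hV₂ hF
  have h3 : action b V₁ V₂ F 0 t u v₁ v₂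
      = action b V₁ V₂ F 0 s u v₁ v₂ + action b V₁ V₂ F s t u v₁ v₂ :=
    (intervalIntegral.integral_add_adjacent_intervals (hc.intervalIntegrable 0 s)
    (hc.intervalIntegrable s t)).symm
  linarith

end DynamicProgramming

/-! ### The Hamilton–Jacobi equation and the optimal controls -/

section HamiltonJacobi

variable {d : ℕ} {b : Module.Basis (Fin d) ℝ (Pt d)} {V₁ V₂ : ℝ → ℝ}
  {F : (Pt d → ℝ) → ℝ} {dF : (Pt d → ℝ) → Pt d → ℝ}

theorem continuous_kineticDensity {X : Type*} [TopologicalSpace X] {a₁ a₂ v₂ : X → ℝ}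
    {v₁ : X → Pt d} (hv₁ : Continuous v₁) (ha₁ : Continuous a₁) (hv₂ : Continuous v₂)
    (ha₂ : Continuous a₂) :
    Continuous fun x => (1 / 2) * ‖v₁ x‖ ^ 2 * a₁ x + (1 / 2) * |v₂ x| ^ 2 * a₂ x := by
  fun_prop

/-- Here `g r` stands for the value at time `t + r`. Only `r ≤ 0` is used, since `t = 1` is allowed
and the value functional is differentiated within `[0, 1]`. -/
theorem hasDerivWithinAt_le_of_sub_le_integral {g ℓ : ℝ → ℝ} {m t : ℝ}
    (hg : HasDerivWithinAt g m (Iic 0) 0) (hℓ : Continuous ℓ)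
    (h : ∀ᶠ r in 𝓝[<] (0 : ℝ), g 0 - g r ≤ ∫ s in (t + r)..t, ℓ s) : m ≤ ℓ t := by
  have hI : HasDerivAt (fun r => ∫ s in t..(t + r), ℓ s) (ℓ t) 0 := by
    have h1 : HasDerivAt (fun y => ∫ s in t..y, ℓ s) (ℓ (t + 0)) (t + 0) :=
      intervalIntegral.integral_hasDerivAt_right (hℓ.intervalIntegrable _ _)
        hℓ.stronglyMeasurable.stronglyMeasurableAtFilter hℓ.continuousAt
    have h2 : HasDerivAt (fun r : ℝ => t + r) 1 0 := (hasDerivAt_id _).const_add t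
    simpa [Function.comp_def] using h1.comp (0 : ℝ) h2
  have hd := (hg.mono Iio_subset_Iic_self).sub (hI.hasDerivWithinAt (s := Iio 0))
  rw [hasDerivWithinAt_iff_tendsto_slope' (by simp)] at hd
  refine sub_nonpos.1 (le_of_tendsto hd ?_)
  filter_upwards [h, self_mem_nhdsWithin] with r hr hr0
  rw [slope_def_field]
  refine div_nonpos_of_nonneg_of_nonpos ?_ (by simpa using (mem_Iio.1 hr0).le)
  simp only [Pi.sub_apply, add_zero, intervalIntegral.integral_same]
  rw [intervalIntegral.integral_symm t (t + r)] at hr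
  linarith

theorem hamiltonJacobi_eq (hV₁ : IsMobility V₁) (hV₂ : IsMobility V₂) {w Φ : Pt d → ℝ}
    (hw : IsDensity b w) (hΦ : IsSmoothPeriodic b Φ) (τ : ℝ) :
    hamiltonJacobi b V₁ V₂ F w τ Φ = τ + kineticEnergy b V₁ V₂ w (gradient Φ) Φ + F w := by
  have h1 := (hV₁.contDiff_comp hw.1.1 hw.2).continuous
  have h2 := (hV₂.contDiff_comp hw.1.1 hw.2).continuous
  have hg := hΦ.contDiff_gradient.continuous
  have hc := hΦ.1.continuous
  rw [hamiltonJacobi, kineticEnergy, integral_add, ← integral_const_mul, ← integral_const_mul]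
  · simp only [mul_assoc, ← add_assoc]
  · exact integrableOn_cell ((continuous_const.mul (hg.norm.pow 2)).mul h1)
  · exact integrableOn_cell ((continuous_const.mul (hc.abs.pow 2)).mul h2)

theorem kineticEnergy_nonneg (hV₁ : IsMobility V₁) (hV₂ : IsMobility V₂) {w : Pt d → ℝ}
    (hw : IsDensity b w) (v₁ : Pt d → Pt d) (v₂ : Pt d → ℝ) :
    0 ≤ kineticEnergy b V₁ V₂ w v₁ v₂ := by
  refine integral_nonneg fun x => ?_
  have h1 := hV₁.nonneg (hw.2 x)
  have h2 := hV₂.nonneg (hw.2 x)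
  simp only [Pi.zero_apply]
  positivity

theorem eq_zero_of_kineticEnergy_eq_zero (hV₁ : IsMobility V₁) (hV₂ : IsMobility V₂)
    {w : Pt d → ℝ} (hw : IsDensity b w) {v₁ : Pt d → Pt d} {v₂ : Pt d → ℝ}
    (hv₁ : Continuous v₁) (hv₁p : ∀ x i, v₁ (x + b i) = v₁ x)
    (hv₂ : Continuous v₂) (hv₂p : ∀ x i, v₂ (x + b i) = v₂ x)
    (h : kineticEnergy b V₁ V₂ w v₁ v₂ = 0) (x : Pt d) :
    (V₁ (w x) ≠ 0 → v₁ x = 0) ∧ (V₂ (w x) ≠ 0 → v₂ x = 0) := by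
  have c1 := (hV₁.contDiff_comp hw.1.1 hw.2).continuous
  have c2 := (hV₂.contDiff_comp hw.1.1 hw.2).continuous
  have h1 := fun x => hV₁.nonneg (hw.2 x)
  have h2 := fun x => hV₂.nonneg (hw.2 x)
  have h0 := congrFun (eq_zero_of_integral_cell_eq_zero (b := b)
    (continuous_kineticDensity hv₁ c1 hv₂ c2) (fun x i => by rw [hv₁p, hv₂p, hw.1.2])
    (fun x => by have := h1 x; have := h2 x; positivity) h) x
  have n1 := h1 x
  have n2 := h2 x
  have m1 : 0 ≤ 1 / 2 * ‖v₁ x‖ ^ 2 * V₁ (w x) := by positivity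
  have m2 : 0 ≤ 1 / 2 * |v₂ x| ^ 2 * V₂ (w x) := by positivity
  obtain ⟨z1, z2⟩ := (add_eq_zero_iff_of_nonneg m1 m2).1 h0
  refine ⟨fun hne => ?_, fun hne => ?_⟩
  · simpa [hne] using z1
  · simpa [hne] using z2

/-- The power `∫_Ω Φ ∂_t u dx` by completion of the square. -/
theorem integral_mul_velocity (hV₁ : IsMobility V₁) (hV₂ : IsMobility V₂) {w Φ : Pt d → ℝ}
    (hw : IsDensity b w) (hΦ : IsSmoothPeriodic b Φ) {v₁ : Pt d → Pt d} {v₂ : Pt d → ℝ}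
    (hv₁ : ContDiff ℝ ∞ v₁) (hv₁p : ∀ x i, v₁ (x + b i) = v₁ x)
    (hv₂ : ContDiff ℝ ∞ v₂) :
    ∫ x in parallelepiped b,
        Φ x * (-divergence (fun y => V₁ (w y) • v₁ y) x + v₂ x * V₂ (w x))
      = kineticEnergy b V₁ V₂ w v₁ v₂ + kineticEnergy b V₁ V₂ w (gradient Φ) Φ
        - kineticEnergy b V₁ V₂ w (fun x => v₁ x - gradient Φ x) (fun x => v₂ x - Φ x) := by
  have s1 := hV₁.contDiff_comp hw.1.1 hw.2
  have c2 := (hV₂.contDiff_comp hw.1.1 hw.2).continuous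
  have ap : ∀ x i, V₁ (w (x + b i)) = V₁ (w x) := fun x i => by rw [hw.1.2]
  simp only [kineticEnergy]
  -- Mobilities are regular only on `(0, ∞)`, so the composites with `w` are made atomic before
  -- continuity is checked by `fun_prop`.
  obtain ⟨a₁, ha₁⟩ : ∃ a : Pt d → ℝ, ∀ x, V₁ (w x) = a x := ⟨_, fun _ => rfl⟩
  obtain ⟨a₂, ha₂⟩ : ∃ a : Pt d → ℝ, ∀ x, V₂ (w x) = a x := ⟨_, fun _ => rfl⟩
  simp only [ha₁, ha₂] at s1 c2 ap ⊢
  have sm : ContDiff ℝ ∞ fun x => a₁ x • v₁ x := s1.smul hv₁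
  have c1 := s1.continuous
  have cg := hΦ.contDiff_gradient.continuous
  have cΦ := hΦ.1.continuous
  have cv₁ := hv₁.continuous
  have cv₂ := hv₂.continuous
  have cdiv := (contDiff_divergence sm).continuous
  have hparts := integral_mul_divergence hΦ sm (fun x i => by rw [ap, hv₁p])
  have e : ∀ x, Φ x * (-divergence (fun y => a₁ y • v₁ y) x + v₂ x * a₂ x)
      = Φ x * (v₂ x * a₂ x) - Φ x * divergence (fun y => a₁ y • v₁ y) x :=
    fun x => by ring
  simp only [e]
  rw [integral_sub (integrableOn_cell (by fun_prop)) (integrableOn_cell (by fun_prop)), hparts,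
    sub_neg_eq_add, ← integral_add (integrableOn_cell (by fun_prop))
      (integrableOn_cell (by fun_prop)),
    ← integral_add (integrableOn_cell (by fun_prop)) (integrableOn_cell (by fun_prop)),
    ← integral_sub (integrableOn_cell (by fun_prop)) (integrableOn_cell (by fun_prop))]
  refine integral_congr_ae (Eventually.of_forall fun x => ?_)
  simp only [inner_smul_right, norm_sub_sq_real, sq_abs]
  rw [real_inner_comm]
  ring

variable {D : Set (Pt d → ℝ)} {ψ : (Pt d → ℝ) → ℝ}

/-- The one-sided expansion at a time `t ∈ (0, 1]` along a smooth curve. -/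
theorem HasSpaceTimeVariationAt.exists_left {𝒰 : ℝ → (Pt d → ℝ) → EReal} {t τ : ℝ}
    (ht : t ∈ Ioc (0 : ℝ) 1) {w Φ : Pt d → ℝ}
    (h : HasSpaceTimeVariationAt b (Icc 0 1) 𝒰 t w τ Φ) {c : ℝ → Pt d → ℝ}
    (hc : IsDensityFamily b c) (hct : c t = w) {k : Pt d → ℝ}
    (hk : ∀ x, HasDerivAt (fun r => c r x) (k x) t) :
    ∃ g : ℝ → ℝ, 𝒰 t w = g 0 ∧ (∀ᶠ r in 𝓝[<] 0, t + r ∈ Ioo 0 t ∧ 𝒰 (t + r) (c (t + r)) = g r) ∧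
      HasDerivWithinAt g (τ + ∫ x in parallelepiped b, Φ x * k x) (Iic 0) 0 := by
  obtain ⟨g, hg, hd⟩ := h.2 (fun r => t + r) (fun r => c (t + r)) (by fun_prop)
    (hc.comp (by fun_prop)) (by simp) (by simpa using hct)
  have hS : (fun r => t + r) ⁻¹' Icc 0 1 ∈ 𝓝[≤] (0 : ℝ) := by
    refine mem_of_superset (Icc_mem_nhdsLE (neg_lt_zero.2 ht.1)) fun r hr => ?_
    exact ⟨by linarith [hr.1], by linarith [hr.2, ht.2]⟩
  have hg' := hg.filter_mono (nhdsWithin_le_of_mem hS)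
  refine ⟨g, ?_, ?_, ?_⟩
  · have := hg'.self_of_nhdsWithin (by simp)
    simpa [hct] using this
  · filter_upwards [hg'.filter_mono (nhdsWithin_mono _ Iio_subset_Iic_self),
      Ioo_mem_nhdsLT (neg_lt_zero.2 ht.1)] with r h1 h2
    exact ⟨⟨by linarith [h2.1], by linarith [h2.2]⟩, h1⟩
  · refine (hd.mono_of_mem_nhdsWithin hS).congr_deriv ?_
    have e1 : deriv (fun r => t + r) 0 = 1 := by
      rw [deriv_const_add]; simp
    rw [e1, one_mul]
    congr 1
    refine integral_congr_ae (Eventually.of_forall fun x => ?_)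
    simp only
    rw [deriv_comp_const_add (f := fun r => c r x), add_zero, (hk x).deriv]

theorem exists_density_line {w k : Pt d → ℝ} (hw : IsDensity b w) (hk : IsSmoothPeriodic b k) :
    ∃ ρ > 0, ∀ s, |s| ≤ ρ → ∀ x, 0 < w x + s * k x := by
  obtain ⟨δ, hδ, hle⟩ := exists_pos_forall_le_of_periodic (b := b) (G := fun _ => w)
    (hw.1.1.continuous.comp continuous_snd) (fun _ => hw.1.2) (fun _ => hw.2)
    (isCompact_singleton (x := (0 : ℝ)))
  obtain ⟨C, hC, hkC⟩ := exists_forall_abs_le_of_periodic hk.1.continuous hk.2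
  refine ⟨δ / (2 * C), by positivity, fun s hs x => ?_⟩
  have h1 : |s * k x| ≤ δ / 2 := by
    rw [abs_mul]
    calc |s| * |k x| ≤ δ / (2 * C) * C := by gcongr; exact hkC x
      _ = δ / 2 := by field_simp
  have h2 := hle 0 (mem_singleton _) x
  have h3 := neg_abs_le (s * k x)
  linarith

theorem IsSmoothPeriodic.velocity (hV₁ : IsMobility V₁) (hV₂ : IsMobility V₂) {w Φ : Pt d → ℝ}
    (hw : IsDensity b w) (hΦ : IsSmoothPeriodic b Φ) :
    IsSmoothPeriodic b (densityVelocity V₁ V₂ w Φ) := by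
  have s1 := hV₁.contDiff_comp hw.1.1 hw.2
  have s2 := hV₂.contDiff_comp hw.1.1 hw.2
  refine ⟨(contDiff_divergence (s1.smul hΦ.contDiff_gradient)).neg.add (s2.mul hΦ.1),
    fun x i => ?_⟩
  simp only [densityVelocity]
  rw [divergence_periodic (b := b) (fun x i => by rw [hw.1.2, gradient_periodic hΦ.2]), hw.1.2,
    hΦ.2]

/-- A path through a density with the velocity of a given momentum. -/
theorem exists_controlledPath (hV₁ : IsMobility V₁) (hV₂ : IsMobility V₂) {w Φ : Pt d → ℝ}
    (hw : IsDensity b w) (hΦ : IsSmoothPeriodic b Φ) (t : ℝ) :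
    ∃ c v₁ v₂, (∀ a a', IsControlledPath b V₁ V₂ a a' c v₁ v₂) ∧ c t = w ∧
      (∀ x, HasDerivAt (fun r => c r x) (densityVelocity V₁ V₂ w Φ x) t) ∧
      kineticEnergy b V₁ V₂ w (v₁ t) (v₂ t) = kineticEnergy b V₁ V₂ w (gradient Φ) Φ := by
  set k := densityVelocity V₁ V₂ w Φ with hkdef
  have hk : IsSmoothPeriodic b k := hΦ.velocity hV₁ hV₂ hw
  obtain ⟨ρ, hρ, hpos⟩ := exists_density_line hw hk
  -- The sine keeps `w + β k` positive for all times, while `β t = 0` and `β' t = 1` give the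
  -- prescribed density and velocity at `t`.
  let β : ℝ → ℝ := fun r => ρ * Real.sin ((r - t) / ρ)
  let β' : ℝ → ℝ := fun r => Real.cos ((r - t) / ρ)
  have hβ : ContDiff ℝ ∞ β := contDiff_const.mul
    (Real.contDiff_sin.comp ((contDiff_id.sub contDiff_const).div_const _))
  have hβ' : ContDiff ℝ ∞ β' :=
    Real.contDiff_cos.comp ((contDiff_id.sub contDiff_const).div_const _)
  have hdβ : ∀ r, HasDerivAt β (β' r) r := fun r => by
    have h1 : HasDerivAt (fun r : ℝ => (r - t) / ρ) (1 / ρ) r :=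
      ((hasDerivAt_id r).sub_const t).div_const ρ
    refine (h1.sin.const_mul ρ).congr_deriv ?_
    simp only [β']
    field_simp
  have hβρ : ∀ r, |β r| ≤ ρ := fun r => by
    rw [abs_mul, abs_of_pos hρ]
    exact mul_le_of_le_one_right hρ.le (Real.abs_sin_le_one _)
  let c : ℝ → Pt d → ℝ := fun r x => w x + β r * k x
  have hcpos : ∀ r x, 0 < c r x := fun r x => hpos _ (hβρ r) x
  have hcs : ContDiff ℝ ∞ fun q : ℝ × Pt d => c q.1 q.2 :=
    (hw.1.1.comp contDiff_snd).add ((hβ.comp contDiff_fst).mul (hk.1.comp contDiff_snd))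
  have hcper : ∀ r x i, c r (x + b i) = c r x := fun r x i => by
    simp only [c, hw.1.2, hk.2]
  have hct : c t = w := by ext x; simp [c, β]
  have hβt : β' t = 1 := by simp [β']
  have hcd : ∀ r x, HasDerivAt (fun r => c r x) (β' r * k x) r := fun r x =>
    ((hdβ r).mul_const _).const_add _
  -- The quotients freeze the fluxes at those of `Φ` at the density `w`, up to the factor `β' r`, in
  -- accordance with `∂_r c = β' k`.
  let v₁ : ℝ → Pt d → Pt d := fun r x => β' r • ((V₁ (w x) / V₁ (c r x)) • gradient Φ x)
  let v₂ : ℝ → Pt d → ℝ := fun r x => β' r * ((V₂ (w x) / V₂ (c r x)) * Φ x)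
  have hw' : ContDiff ℝ ∞ fun q : ℝ × Pt d => w q.2 := hw.1.1.comp contDiff_snd
  refine ⟨c, v₁, v₂, fun a a' => ⟨⟨⟨hcs, hcper⟩, hcpos⟩, ⟨?_, ?_⟩, ⟨?_, ?_⟩, ?_⟩, hct, ?_, ?_⟩
  · exact (hβ'.comp contDiff_fst).smul ((hV₁.contDiff_div hw' hcs (fun q => hw.2 q.2)
      fun q => hcpos q.1 q.2).smul (hΦ.contDiff_gradient.comp contDiff_snd))
  · intro r x i
    simp only [v₁, hcper, hw.1.2, gradient_periodic hΦ.2]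
  · exact (hβ'.comp contDiff_fst).mul ((hV₂.contDiff_div hw' hcs (fun q => hw.2 q.2)
      fun q => hcpos q.1 q.2).mul (hΦ.1.comp contDiff_snd))
  · intro r x i
    simp only [v₂, hcper, hw.1.2, hΦ.2]
  · intro r _ x
    refine (hcd r x).congr_deriv ?_
    have e1 : (fun y => V₁ (c r y) • v₁ r y)
        = fun y => β' r • (V₁ (w y) • gradient Φ y) := by
      ext1 y
      simp only [v₁]
      rw [smul_comm, smul_smul (V₁ (c r y)), hV₁.mul_div (hw.2 y) (hcpos r y)]
    have e2 : v₂ r x * V₂ (c r x) = β' r * (V₂ (w x) * Φ x) := by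
      rw [← hV₂.mul_div (hw.2 x) (hcpos r x)]
      simp only [v₂]
      ring
    rw [e1, e2, divergence_const_smul, hkdef, densityVelocity]
    · ring
    · exact ((hV₁.contDiff_comp hw.1.1 hw.2).smul hΦ.contDiff_gradient).differentiable (by simp)
  · intro x
    simpa [hβt] using hcd t x
  · refine integral_congr_ae (Eventually.of_forall fun x => ?_)
    simp only [v₁, v₂, hct, hβt, one_smul, one_mul]
    by_cases h1 : V₁ (w x) = 0 <;> by_cases h2 : V₂ (w x) = 0 <;> simp [h1, h2]

/-- At the end of a minimizer the Hamilton–Jacobi equation holds, and the controls are given by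
the first variation of the value functional. -/
theorem IsMinimizer.hamiltonJacobi (hV₁ : IsMobility V₁) (hV₂ : IsMobility V₂)
    (hF : IsEnergy b F dF) {t τ : ℝ} (ht : t ∈ Ioc (0 : ℝ) 1) {u : ℝ → Pt d → ℝ}
    {v₁ : ℝ → Pt d → Pt d} {v₂ : ℝ → Pt d → ℝ} {Φ : Pt d → ℝ}
    (hmin : IsMinimizer b V₁ V₂ F D ψ t u v₁ v₂)
    (hU : HasSpaceTimeVariationAt b (Icc 0 1) (valueFunctional b V₁ V₂ F D ψ) t (u t) τ Φ) :
    hamiltonJacobi b V₁ V₂ F (u t) τ Φ = 0 ∧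
      ∀ x, (V₁ (u t x) ≠ 0 → v₁ t x = gradient Φ x) ∧ (V₂ (u t x) ≠ 0 → v₂ t x = Φ x) := by
  have hw := hmin.1.density.isDensity t
  have hΦ := hU.1
  rw [hamiltonJacobi_eq hV₁ hV₂ hw hΦ]
  -- Along the minimizer the value grows exactly by the action. The comparison lemma, applied with
  -- reversed signs, bounds the growth rate from below by the Lagrangian.
  have hlower : kineticEnergy b V₁ V₂ (u t) (fun x => v₁ t x - gradient Φ x)
      (fun x => v₂ t x - Φ x) ≤ τ + kineticEnergy b V₁ V₂ (u t) (gradient Φ) Φ + F (u t) := by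
    obtain ⟨g, hg0, hg, hd⟩ := hU.exists_left ht hmin.1.density rfl
      (fun x => hmin.1.equation t ⟨ht.1.le, le_rfl⟩ x)
    have hc := hmin.1.continuous_lagrangian hV₁ hV₂ hF
    have hm := hasDerivWithinAt_le_of_sub_le_integral hd.neg hc.neg (t := t) (by
      filter_upwards [hg] with r hr
      have h1 := hmin.valueFunctional_eq hV₁ hV₂ hF hr.1 hr.2
      have h2 := hmin.2.2
      rw [hg0, EReal.coe_eq_coe_iff] at h2
      have h3 := intervalIntegral.integral_add_adjacent_intervals
        (hc.intervalIntegrable 0 (t + r)) (hc.intervalIntegrable (μ := volume) (t + r) t)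
      simp only [Pi.neg_apply]
      rw [intervalIntegral.integral_neg, h1, h2, action_eq, action_eq]
      linarith)
    rw [integral_mul_velocity hV₁ hV₂ hw hΦ (contDiff_slice hmin.1.transport t)
      (hmin.1.transport.2 t) (contDiff_slice hmin.1.reaction t)] at hm
    simp only [Pi.neg_apply] at hm
    linarith
  -- The competitor is driven by `Φ` itself, for which the square in `integral_mul_velocity`
  -- vanishes.
  have hupper : τ + kineticEnergy b V₁ V₂ (u t) (gradient Φ) Φ + F (u t) ≤ 0 := by
    obtain ⟨c, z₁, z₂, hc, hct, hcd, hkin⟩ := exists_controlledPath hV₁ hV₂ hw hΦ t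
    obtain ⟨g, hg0, hg, hd⟩ := hU.exists_left ht (hc 0 0).density hct hcd
    have hcl := (hc 0 0).continuous_lagrangian hV₁ hV₂ hF
    have hm := hasDerivWithinAt_le_of_sub_le_integral hd hcl (t := t) (by
      filter_upwards [hg] with r hr
      have h1 := valueFunctional_le_add_action hV₁ hV₂ hF hr.1.1 hr.1.2 (hc _ _) hr.2
      rw [hct, hg0, EReal.coe_le_coe_iff, action_eq] at h1
      linarith)
    simp only [hct, hkin] at hm
    have hpow := integral_mul_velocity hV₁ hV₂ hw hΦ hΦ.contDiff_gradient
      (gradient_periodic hΦ.2) hΦ.1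
    have hzero : kineticEnergy b V₁ V₂ (u t) (fun x => gradient Φ x - gradient Φ x)
        (fun x => Φ x - Φ x) = 0 := by simp [kineticEnergy]
    rw [hzero] at hpow
    simp only [densityVelocity, mul_comm (V₂ _) (Φ _)] at hm
    linarith
  have hnn := kineticEnergy_nonneg hV₁ hV₂ hw (fun x => v₁ t x - gradient Φ x)
    (fun x => v₂ t x - Φ x)
  refine ⟨le_antisymm hupper (hnn.trans hlower), fun x => ?_⟩
  have := eq_zero_of_kineticEnergy_eq_zero hV₁ hV₂ hw
    (((contDiff_slice hmin.1.transport t).sub hΦ.contDiff_gradient).continuous)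
    (fun x i => by rw [hmin.1.transport.2, gradient_periodic hΦ.2])
    (((contDiff_slice hmin.1.reaction t).sub hΦ.1).continuous)
    (fun x i => by rw [hmin.1.reaction.2, hΦ.2])
    (le_antisymm (hlower.trans hupper) hnn) x
  simpa only [sub_eq_zero] using this

end HamiltonJacobi

/-! ### First variations of the Hamiltonian -/

section HamiltonSystem

variable {d : ℕ} {b : Module.Basis (Fin d) ℝ (Pt d)} {V₁ V₂ : ℝ → ℝ}
  {F : (Pt d → ℝ) → ℝ} {dF : (Pt d → ℝ) → Pt d → ℝ}

theorem IsSmoothFamily.deriv_eq {c : ℝ → Pt d → ℝ} (hc : IsSmoothFamily b c) (s : ℝ) (x : Pt d) :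
    deriv (fun r => c r x) s = fderiv ℝ (fun q : ℝ × Pt d => c q.1 q.2) (s, x) (1, 0) := by
  have h1 : HasDerivAt (fun r : ℝ => (r, x)) ((1 : ℝ), (0 : Pt d)) s :=
    (hasDerivAt_id s).prodMk (hasDerivAt_const s x)
  have h2 := (hc.1.differentiable (by simp) (s, x)).hasFDerivAt
  exact (h2.comp_hasDerivAt s h1).deriv

theorem IsSmoothFamily.fderiv_eq {c : ℝ → Pt d → ℝ} (hc : IsSmoothFamily b c) (s : ℝ) (x : Pt d) :
    fderiv ℝ (c s) x = (fderiv ℝ (fun q : ℝ × Pt d => c q.1 q.2) (s, x)).comp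
      (ContinuousLinearMap.inr ℝ ℝ (Pt d)) := by
  have h1 : HasFDerivAt (fun y : Pt d => (s, y)) (ContinuousLinearMap.inr ℝ ℝ (Pt d)) x :=
    hasFDerivAt_prodMk_right s x
  have h2 := (hc.1.differentiable (by simp) (s, x)).hasFDerivAt
  exact (h2.comp x h1).fderiv

/-- The velocity of a smooth family is a smooth family. -/
theorem IsSmoothFamily.velocity {c : ℝ → Pt d → ℝ} (hc : IsSmoothFamily b c) :
    IsSmoothFamily b fun s x => deriv (fun r => c r x) s := by
  refine ⟨?_, fun s x i => by simp only [hc.2]⟩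
  simp only [hc.deriv_eq]
  have h : ContDiff ℝ ∞ (fderiv ℝ fun q : ℝ × Pt d => c q.1 q.2) := hc.1.fderiv_right (by simp)
  exact h.clm_apply contDiff_const

theorem IsSmoothFamily.gradient_slice {c : ℝ → Pt d → ℝ} (hc : IsSmoothFamily b c) :
    IsSmoothFamily b fun s => gradient (c s) := by
  refine ⟨?_, fun s => gradient_periodic (hc.2 s)⟩
  have h : ContDiff ℝ ∞ (fderiv ℝ fun q : ℝ × Pt d => c q.1 q.2) := hc.1.fderiv_right (by simp)
  unfold gradient
  simp only [hc.fderiv_eq]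
  exact (InnerProductSpace.toDual ℝ (Pt d)).symm.contDiff.comp (h.clm_comp contDiff_const)

/-- Symmetry of the second derivative, in the form needed to exchange the parameter derivative of a
family with its spatial gradient. -/
theorem fderiv_fderiv_prod_comm {E : Type*} [NormedAddCommGroup E] [NormedSpace ℝ E]
    {C : ℝ × E → ℝ} (hC : ContDiff ℝ ∞ C) (s : ℝ) (x v : E) :
    HasDerivAt (fun r => fderiv ℝ C (r, x) (0, v))
      (fderiv ℝ (fun y => fderiv ℝ C (s, y) (1, 0)) x v) s := by
  have hD : ContDiff ℝ ∞ (fderiv ℝ C) := hC.fderiv_right (by simp)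
  have h2 : (2 : WithTop ℕ∞) ≤ ∞ := WithTop.coe_le_coe.2 (le_top : (2 : ℕ∞) ≤ ⊤)
  have hsymm : IsSymmSndFDerivAt ℝ C (s, x) :=
    hC.contDiffAt.isSymmSndFDerivAt (by simpa using h2)
  have hDd := (hD.differentiable (by simp) (s, x)).hasFDerivAt
  have h1 : HasDerivAt (fun r : ℝ => (r, x)) ((1 : ℝ), (0 : E)) s :=
    (hasDerivAt_id s).prodMk (hasDerivAt_const s x)
  have h3 : HasFDerivAt (fun y : E => (s, y)) (ContinuousLinearMap.inr ℝ ℝ E) x :=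
    hasFDerivAt_prodMk_right s x
  have l1 : HasDerivAt (fun r => fderiv ℝ C (r, x)) (fderiv ℝ (fderiv ℝ C) (s, x) (1, 0)) s :=
    hDd.comp_hasDerivAt s h1
  have l2 : HasFDerivAt (fun y => fderiv ℝ C (s, y))
      ((fderiv ℝ (fderiv ℝ C) (s, x)).comp (ContinuousLinearMap.inr ℝ ℝ E)) x := hDd.comp x h3
  have l3 := (l2.clm_apply (hasFDerivAt_const ((1 : ℝ), (0 : E)) x)).fderiv
  have l4 := l1.clm_apply (hasDerivAt_const s ((0 : ℝ), v))
  rw [l3]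
  refine l4.congr_deriv ?_
  simp [hsymm.eq (1, 0) (0, v)]

theorem IsSmoothFamily.deriv_gradient {c : ℝ → Pt d → ℝ} (hc : IsSmoothFamily b c) (s : ℝ)
    (x : Pt d) : deriv (fun r => gradient (c r) x) s
      = gradient (fun y => deriv (fun r => c r y) s) x := by
  refine ext_inner_right ℝ fun v => ?_
  have l1 := ((hc.gradient_slice.hasDerivAt s x).inner ℝ (hasDerivAt_const s v))
  simp only [inner_zero_right, zero_add] at l1
  have l2 := fderiv_fderiv_prod_comm hc.1 s x v
  rw [← fderiv_eq_inner_gradient]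
  simp only [hc.deriv_eq]
  refine l1.unique (l2.congr_of_eventuallyEq (Eventually.of_forall fun r => ?_))
  simp only [← fderiv_eq_inner_gradient, hc.fderiv_eq]
  simp

/-- With `κ` the velocity of the test curve, the derivative is `∫ ⟨∇Φ, ∇κ⟩ V₁(u) + Φ κ V₂(u)`;
integration by parts takes the gradient off `κ`. -/
theorem hamiltonian_hasFreeFirstVariationAt (hV₁ : IsMobility V₁) (hV₂ : IsMobility V₂)
    {u Φ : Pt d → ℝ} (hu : IsDensity b u) (hΦ : IsSmoothPeriodic b Φ) :
    HasFreeFirstVariationAt b (fun Ψ => hamiltonian b V₁ V₂ F u Ψ) Φ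
      (densityVelocity V₁ V₂ u Φ) := by
  intro c hc hc0
  have s1 := hV₁.contDiff_comp hu.1.1 hu.2
  have s2 := hV₂.contDiff_comp hu.1.1 hu.2
  have c1 := s1.continuous
  have c2 := s2.continuous
  have hg := hc.gradient_slice
  have hcd := hc.velocity
  have hgd : IsSmoothFamily b fun s => gradient fun y => deriv (fun r => c r y) s := hcd.gradient_slice
  have cc := hc.1.continuous
  have cg := hg.1.continuous
  have ccd := hcd.1.continuous
  have cgd := hgd.1.continuous
  have c1' : Continuous fun q : ℝ × Pt d => V₁ (u q.2) := c1.comp continuous_snd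
  have c2' : Continuous fun q : ℝ × Pt d => V₂ (u q.2) := c2.comp continuous_snd
  have key := hasDerivAt_setIntegral (μ := volume) (isCompact_cell b) (measurableSet_cell b)
    (G := fun s x => (1 / 2) * ‖gradient (c s) x‖ ^ 2 * V₁ (u x)
      + (1 / 2) * |c s x| ^ 2 * V₂ (u x))
    (G' := fun s x => inner ℝ (gradient (c s) x) (gradient (fun y => deriv (fun r => c r y) s) x)
        * V₁ (u x) + c s x * deriv (fun r => c r x) s * V₂ (u x))
    (fun s => by
      have h1 := (contDiff_slice hc s).continuous
      have h2 := (contDiff_slice hg s).continuous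
      exact (((continuous_const.mul (h2.norm.pow 2)).mul c1).add
        ((continuous_const.mul (h1.abs.pow 2)).mul c2)).continuousOn)
    ((((cg.inner cgd).mul c1').add ((cc.mul ccd).mul c2')).continuousOn)
    (fun s x _ => by
      have h1 := (hc.hasDerivAt s x).pow 2
      have h2 := (hg.hasDerivAt s x).norm_sq
      rw [hc.deriv_gradient] at h2
      simp only [sq_abs]
      refine (((h2.const_mul (1 / 2)).mul_const _).add
        ((h1.const_mul (1 / 2)).mul_const _)).congr_deriv ?_
      norm_num
      ring) 0
  refine (key.add_const (F u)).congr_deriv ?_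
  set κ : Pt d → ℝ := fun x => deriv (fun r => c r x) 0 with hκ
  have hκs : IsSmoothPeriodic b κ := ⟨contDiff_slice hcd 0, hcd.2 0⟩
  have sm : ContDiff ℝ ∞ fun x => V₁ (u x) • gradient Φ x := s1.smul hΦ.contDiff_gradient
  have hparts := integral_mul_divergence hκs sm
    (fun x i => by rw [hu.1.2, gradient_periodic hΦ.2])
  have hgc := hΦ.contDiff_gradient.continuous
  have hκc := hκs.1.continuous
  have hκg := hκs.contDiff_gradient.continuous
  have hΦc := hΦ.1.continuous
  have cdiv := (contDiff_divergence sm).continuous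
  simp only [hc0]
  have e : ∀ x, densityVelocity V₁ V₂ u Φ x * deriv (fun r => c r x) 0
      = Φ x * κ x * V₂ (u x) - κ x * divergence (fun y => V₁ (u y) • gradient Φ y) x :=
    fun x => by
      change _ * κ x = _
      rw [densityVelocity]
      ring
  simp only [e]
  have i1 : Continuous fun x => Φ x * κ x * V₂ (u x) := (hΦc.mul hκc).mul c2
  have i2 : Continuous fun x => κ x * divergence (fun y => V₁ (u y) • gradient Φ y) x :=
    hκc.mul cdiv
  have i3 : Continuous fun x => inner ℝ (gradient κ x) (V₁ (u x) • gradient Φ x) :=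
    hκg.inner sm.continuous
  rw [integral_sub (integrableOn_cell i1) (integrableOn_cell i2), hparts, sub_neg_eq_add,
    ← integral_add (integrableOn_cell i1) (integrableOn_cell i3)]
  refine integral_congr_ae (Eventually.of_forall fun x => ?_)
  simp only [inner_smul_right]
  rw [real_inner_comm (gradient Φ x) (gradient κ x)]
  simp only [hκ]
  ring

theorem hamiltonian_hasFirstVariationAt (hV₁ : IsMobility V₁) (hV₂ : IsMobility V₂)
    (hF : IsEnergy b F dF) {u Φ : Pt d → ℝ} (hu : IsDensity b u) (hΦ : IsSmoothPeriodic b Φ) :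
    HasFirstVariationAt b (fun w => hamiltonian b V₁ V₂ F w Φ) u (momentumForce V₁ V₂ dF u Φ) := by
  intro c hc hc0
  have hgc := hΦ.contDiff_gradient.continuous
  have hΦc := hΦ.1.continuous
  have hpos : ∀ q : ℝ × Pt d, 0 < c q.1 q.2 := fun q => hc.2 q.1 q.2
  have cc := hc.1.1.continuous
  have ccd := hc.1.velocity.1.continuous
  have d1 : Continuous fun q : ℝ × Pt d => deriv V₁ (c q.1 q.2) :=
    hV₁.continuousOn_deriv.comp_continuous cc hpos
  have d2 : Continuous fun q : ℝ × Pt d => deriv V₂ (c q.1 q.2) :=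
    hV₂.continuousOn_deriv.comp_continuous cc hpos
  have key := hasDerivAt_setIntegral (μ := volume) (isCompact_cell b) (measurableSet_cell b)
    (G := fun s x => (1 / 2) * ‖gradient Φ x‖ ^ 2 * V₁ (c s x)
      + (1 / 2) * |Φ x| ^ 2 * V₂ (c s x))
    (G' := fun s x => ((1 / 2) * ‖gradient Φ x‖ ^ 2 * deriv V₁ (c s x)
      + (1 / 2) * |Φ x| ^ 2 * deriv V₂ (c s x)) * deriv (fun r => c r x) s)
    (fun s => by
      have h1 := (hV₁.contDiff_comp (contDiff_slice hc.1 s) (hc.2 s)).continuous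
      have h2 := (hV₂.contDiff_comp (contDiff_slice hc.1 s) (hc.2 s)).continuous
      exact (continuous_kineticDensity hgc h1 hΦc h2).continuousOn)
    (((((continuous_const.mul ((hgc.comp continuous_snd).norm.pow 2)).mul d1).add
      ((continuous_const.mul ((hΦc.comp continuous_snd).abs.pow 2)).mul d2)).mul ccd).continuousOn)
    (fun s x _ => by
      have h0 := hc.1.hasDerivAt s x
      have h1 := (hV₁.hasDerivAt (hc.2 s x)).comp s h0
      have h2 := (hV₂.hasDerivAt (hc.2 s x)).comp s h0
      refine ((h1.const_mul _).add (h2.const_mul _)).congr_deriv ?_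
      ring) 0
  refine (key.add (hF.variation u hu c hc hc0)).congr_deriv ?_
  have cd0 : Continuous fun x => deriv (fun r => c r x) 0 := (contDiff_slice hc.1.velocity 0).continuous
  -- Continuity of `dF` is available along two-parameter families, so the curve is given an idle
  -- parameter.
  have cF : Continuous (dF u) :=
    (hF.continuous (fun q => c q.2) (hc.comp contDiff_snd)).comp
      (g := fun q : (ℝ × ℝ) × Pt d => dF (c q.1.2) q.2) (f := fun x => ((0, 0), x)) (by fun_prop)
      |>.congr (fun x => by simp [hc0])
  have du1 : Continuous fun x => deriv V₁ (u x) :=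
    hV₁.continuousOn_deriv.comp_continuous hu.1.1.continuous hu.2
  have du2 : Continuous fun x => deriv V₂ (u x) :=
    hV₂.continuousOn_deriv.comp_continuous hu.1.1.continuous hu.2
  simp only [hc0]
  have i1 : Continuous fun x => ((1 / 2) * ‖gradient Φ x‖ ^ 2 * deriv V₁ (u x)
      + (1 / 2) * |Φ x| ^ 2 * deriv V₂ (u x)) * deriv (fun r => c r x) 0 :=
    (continuous_kineticDensity hgc du1 hΦc du2).mul cd0
  have i2 : Continuous fun x => dF u x * deriv (fun r => c r x) 0 := cF.mul cd0
  rw [← integral_add (integrableOn_cell i1) (integrableOn_cell i2)]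
  refine integral_congr_ae (Eventually.of_forall fun x => ?_)
  simp only [momentumForce]
  ring

end HamiltonSystem

/-! ### The momentum equation by variations at fixed flux -/

section Momentum

variable {d : ℕ} {b : Module.Basis (Fin d) ℝ (Pt d)} {V V₁ V₂ : ℝ → ℝ}
  {F : (Pt d → ℝ) → ℝ} {dF : (Pt d → ℝ) → Pt d → ℝ}

/-- The kinetic energy of a fixed flux is inversely proportional to the mobility at the varied
density; this is the source of the minus sign in the momentum equation. -/
theorem IsMobility.hasDerivAt_mul_div (hV : IsMobility V) {r f' s : ℝ} {f : ℝ → ℝ} (hr : 0 < r)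
    (hf : ∀ e, 0 < f e) (hd : HasDerivAt f f' s) :
    HasDerivAt (fun e => V r * (V r / V (f e))) (-(V r / V (f s)) ^ 2 * deriv V (f s) * f') s := by
  rcases hV.2 with h | h
  · have h1 := (hV.hasDerivAt (hf s)).comp s hd
    have hne := (h _ (hf s)).ne'
    refine (((hasDerivAt_const s (V r)).div h1 hne).const_mul (V r)).congr_deriv ?_
    simp only [Function.comp_apply]
    field_simp
    ring
  · simp only [h r hr, zero_mul, zero_div]
    refine (hasDerivAt_const s (0 : ℝ)).congr_deriv ?_
    ring

theorem IsMobility.div_self_sq_mul_deriv (hV : IsMobility V) {r : ℝ} (hr : 0 < r) :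
    (V r / V r) ^ 2 * deriv V r = deriv V r := by
  by_cases h : V r = 0
  · rw [hV.deriv_eq_zero hr h, mul_zero]
  · rw [div_self h, one_pow, one_mul]

/-- The Lagrangian at the density `p` of the controls whose fluxes are those of the controls
`v₁`, `v₂` at the density `u`. -/
noncomputable def fluxLagrangian (b : Module.Basis (Fin d) ℝ (Pt d)) (V₁ V₂ : ℝ → ℝ)
    (F : (Pt d → ℝ) → ℝ) (u : Pt d → ℝ) (v₁ : Pt d → Pt d) (v₂ p : Pt d → ℝ) : ℝ :=
  kineticEnergy b V₁ V₂ p (fun x => (V₁ (u x) / V₁ (p x)) • v₁ x)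
    (fun x => (V₂ (u x) / V₂ (p x)) * v₂ x) - F p

theorem fluxLagrangian_self (u : Pt d → ℝ) (v₁ : Pt d → Pt d) (v₂ : Pt d → ℝ) :
    fluxLagrangian b V₁ V₂ F u v₁ v₂ u = kineticEnergy b V₁ V₂ u v₁ v₂ - F u := by
  rw [fluxLagrangian]
  congr 1
  refine integral_congr_ae (Eventually.of_forall fun x => ?_)
  by_cases h1 : V₁ (u x) = 0 <;> by_cases h2 : V₂ (u x) = 0 <;> simp [h1, h2]

theorem fluxLagrangian_eq (u : Pt d → ℝ) (v₁ : Pt d → Pt d) (v₂ p : Pt d → ℝ) :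
    fluxLagrangian b V₁ V₂ F u v₁ v₂ p
      = (∫ x in parallelepiped b, ((1 / 2) * ‖v₁ x‖ ^ 2 * (V₁ (u x) * (V₁ (u x) / V₁ (p x)))
        + (1 / 2) * |v₂ x| ^ 2 * (V₂ (u x) * (V₂ (u x) / V₂ (p x))))) - F p := by
  rw [fluxLagrangian, kineticEnergy]
  congr 1
  refine integral_congr_ae (Eventually.of_forall fun x => ?_)
  have h : ∀ y z : ℝ, (z / y) ^ 2 * y = z * (z / y) := fun y z => by
    by_cases hy : y = 0
    · simp [hy]
    · field_simp
  simp only [norm_smul, mul_pow, abs_mul, Real.norm_eq_abs, sq_abs]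
  rw [← h (V₁ (p x)), ← h (V₂ (p x))]
  ring

theorem continuous_fluxLagrangian (hV₁ : IsMobility V₁) (hV₂ : IsMobility V₂)
    (hF : IsEnergy b F dF) {u p : ℝ → Pt d → ℝ} {v₁ : ℝ → Pt d → Pt d} {v₂ : ℝ → Pt d → ℝ}
    (hu : IsDensityFamily b u) (hp : IsDensityFamily b p)
    (hv₁ : Continuous fun q : ℝ × Pt d => v₁ q.1 q.2)
    (hv₂ : Continuous fun q : ℝ × Pt d => v₂ q.1 q.2) :
    Continuous fun r => fluxLagrangian b V₁ V₂ F (u r) (v₁ r) (v₂ r) (p r) := by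
  have r1 := (hV₁.contDiff_div hu.1.1 hp.1.1 (fun q => hu.2 q.1 q.2)
    fun q => hp.2 q.1 q.2).continuous
  have r2 := (hV₂.contDiff_div hu.1.1 hp.1.1 (fun q => hu.2 q.1 q.2)
    fun q => hp.2 q.1 q.2).continuous
  exact (continuous_kineticEnergy hV₁ hV₂ hp (r1.smul hv₁) (r2.mul hv₂)).sub
    (hF.continuous_comp hp)

/-- The derivative of the action in the density, at fixed fluxes. -/
theorem hasDerivAt_integral_fluxLagrangian (hV₁ : IsMobility V₁) (hV₂ : IsMobility V₂)
    (hF : IsEnergy b F dF) {u h : ℝ → Pt d → ℝ} {v₁ : ℝ → Pt d → Pt d} {v₂ : ℝ → Pt d → ℝ}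
    (hu : IsDensityFamily b u)
    (hc : IsDensityFamily b fun (q : ℝ × ℝ) x => u q.2 x + Real.sin q.1 * h q.2 x)
    (hh : Continuous fun q : ℝ × Pt d => h q.1 q.2)
    (hv₁ : Continuous fun q : ℝ × Pt d => v₁ q.1 q.2)
    (hv₂ : Continuous fun q : ℝ × Pt d => v₂ q.1 q.2) {s s' : ℝ} (hs : s ≤ s') :
    HasDerivAt (fun e => ∫ r in s..s', fluxLagrangian b V₁ V₂ F (u r) (v₁ r) (v₂ r)
        (fun x => u r x + Real.sin e * h r x))
      (-∫ r in s..s', ∫ x in parallelepiped b,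
        ((1 / 2) * ‖v₁ r x‖ ^ 2 * deriv V₁ (u r x) + (1 / 2) * |v₂ r x| ^ 2 * deriv V₂ (u r x)
          + dF (u r) x) * h r x) 0 := by
  set c : ℝ × ℝ → Pt d → ℝ := fun q x => u q.2 x + Real.sin q.1 * h q.2 x with hcdef
  have hcr : ∀ r, IsDensityFamily b fun e => c (e, r) := fun r =>
    hc.comp (f := fun e : ℝ => (e, r)) (contDiff_id.prodMk contDiff_const)
  have hce : ∀ e, IsDensityFamily b fun r => c (e, r) := fun e =>
    hc.comp (f := fun r : ℝ => (e, r)) (contDiff_const.prodMk contDiff_id)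
  have hcd : ∀ e r x, HasDerivAt (fun e => c (e, r) x) (Real.cos e * h r x) e := fun e r x =>
    ((Real.hasDerivAt_sin e).mul_const (h r x)).const_add (u r x)
  have hus : ContDiff ℝ ∞ fun q : (ℝ × ℝ) × Pt d => u q.1.2 q.2 :=
    hu.1.1.comp (g := fun q : ℝ × Pt d => u q.1 q.2)
      (f := fun q : (ℝ × ℝ) × Pt d => (q.1.2, q.2)) (by fun_prop)
  have hup : ∀ q : (ℝ × ℝ) × Pt d, 0 < u q.1.2 q.2 := fun q => hu.2 _ _
  have hcp : ∀ q : (ℝ × ℝ) × Pt d, 0 < c q.1 q.2 := fun q => hc.2 _ _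
  have r1 := (hV₁.contDiff_div hus hc.1.1 hup hcp).continuous
  have r2 := (hV₂.contDiff_div hus hc.1.1 hup hcp).continuous
  have d1 : Continuous fun q : (ℝ × ℝ) × Pt d => deriv V₁ (c q.1 q.2) :=
    hV₁.continuousOn_deriv.comp_continuous hc.1.1.continuous hcp
  have d2 : Continuous fun q : (ℝ × ℝ) × Pt d => deriv V₂ (c q.1 q.2) :=
    hV₂.continuousOn_deriv.comp_continuous hc.1.1.continuous hcp
  have w1 : Continuous fun q : (ℝ × ℝ) × Pt d => v₁ q.1.2 q.2 :=
    hv₁.comp (g := fun q : ℝ × Pt d => v₁ q.1 q.2)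
      (f := fun q : (ℝ × ℝ) × Pt d => (q.1.2, q.2)) (by fun_prop)
  have w2 : Continuous fun q : (ℝ × ℝ) × Pt d => v₂ q.1.2 q.2 :=
    hv₂.comp (g := fun q : ℝ × Pt d => v₂ q.1 q.2)
      (f := fun q : (ℝ × ℝ) × Pt d => (q.1.2, q.2)) (by fun_prop)
  have wh : Continuous fun q : (ℝ × ℝ) × Pt d => Real.cos q.1.1 * h q.1.2 q.2 :=
    (Real.continuous_cos.comp (by fun_prop)).mul (hh.comp (g := fun q : ℝ × Pt d => h q.1 q.2)
      (f := fun q : (ℝ × ℝ) × Pt d => (q.1.2, q.2)) (by fun_prop))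
  -- `P` is the derivative in `e` of the kinetic integrand. Differentiation passes first under the
  -- space integral (`hinner`), then under the time integral (`key`); joint continuity of `P` serves
  -- for both.
  let P : ℝ × ℝ → Pt d → ℝ := fun q x =>
    ((1 / 2) * ‖v₁ q.2 x‖ ^ 2 * (-(V₁ (u q.2 x) / V₁ (c q x)) ^ 2 * deriv V₁ (c q x))
      + (1 / 2) * |v₂ q.2 x| ^ 2 * (-(V₂ (u q.2 x) / V₂ (c q x)) ^ 2 * deriv V₂ (c q x)))
      * (Real.cos q.1 * h q.2 x)
  have hP : Continuous fun q : (ℝ × ℝ) × Pt d => P q.1 q.2 :=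
    (continuous_kineticDensity w1 ((r1.pow 2).neg.mul d1) w2 ((r2.pow 2).neg.mul d2)).mul wh
  have hFc : Continuous fun q : (ℝ × ℝ) × Pt d => dF (c q.1) q.2 * (Real.cos q.1.1 * h q.1.2 q.2) :=
    (hF.continuous c hc).mul wh
  have hinner : ∀ e r, HasDerivAt
      (fun e => fluxLagrangian b V₁ V₂ F (u r) (v₁ r) (v₂ r) (c (e, r)))
      ((∫ x in parallelepiped b, P (e, r) x)
        - ∫ x in parallelepiped b, dF (c (e, r)) x * (Real.cos e * h r x)) e := by
    intro e r
    simp only [fluxLagrangian_eq]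
    refine HasDerivAt.sub ?_ ?_
    · refine hasDerivAt_setIntegral (μ := volume) (isCompact_cell b) (measurableSet_cell b)
        (G' := fun e x => P (e, r) x) (fun e => ?_) ?_ (fun e x _ => ?_) e
      · have a1 := (hV₁.contDiff_comp (contDiff_slice hu.1 r) (hu.2 r)).continuous
        have a2 := (hV₂.contDiff_comp (contDiff_slice hu.1 r) (hu.2 r)).continuous
        have q1 : Continuous fun x => V₁ (u r x) / V₁ (c (e, r) x) :=
          r1.comp (f := fun x : Pt d => ((e, r), x)) (by fun_prop)
        have q2 : Continuous fun x => V₂ (u r x) / V₂ (c (e, r) x) :=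
          r2.comp (f := fun x : Pt d => ((e, r), x)) (by fun_prop)
        have z1 : Continuous (v₁ r) := hv₁.comp (f := fun x : Pt d => (r, x)) (by fun_prop)
        have z2 : Continuous (v₂ r) := hv₂.comp (f := fun x : Pt d => (r, x)) (by fun_prop)
        exact (continuous_kineticDensity z1 (a1.mul q1) z2 (a2.mul q2)).continuousOn
      · exact (hP.comp (f := fun q : ℝ × Pt d => ((q.1, r), q.2)) (by fun_prop)).continuousOn
      · have t1 := hV₁.hasDerivAt_mul_div (hu.2 r x) (fun e => hc.2 (e, r) x) (hcd e r x)
        have t2 := hV₂.hasDerivAt_mul_div (hu.2 r x) (fun e => hc.2 (e, r) x) (hcd e r x)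
        refine ((t1.const_mul _).add (t2.const_mul _)).congr_deriv ?_
        simp only [P]
        ring
    · have := hF.hasDerivAt (hcr r) e
      simpa only [(hcd e r _).deriv] using this
  have hG' : Continuous fun q : ℝ × ℝ => (∫ x in parallelepiped b, P q x)
      - ∫ x in parallelepiped b, dF (c q) x * (Real.cos q.1 * h q.2 x) :=
    (continuous_integral_cell hP).sub (continuous_integral_cell hFc)
  have key := hasDerivAt_setIntegral (μ := volume) (isCompact_Icc (a := s) (b := s'))
    measurableSet_Icc
    (fun e => (continuous_fluxLagrangian hV₁ hV₂ hF hu (hce e) hv₁ hv₂).continuousOn)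
    hG'.continuousOn (fun e r _ => hinner e r) 0
  simp only [intervalIntegral.integral_of_le hs, ← integral_Icc_eq_integral_Ioc]
  refine key.congr_deriv ?_
  rw [← integral_neg]
  refine integral_congr_ae (Eventually.of_forall fun r => ?_)
  simp only
  have iP : Continuous fun x => P (0, r) x :=
    hP.comp (f := fun x : Pt d => ((0, r), x)) (by fun_prop)
  have iF : Continuous fun x => dF (c (0, r)) x * (Real.cos 0 * h r x) :=
    hFc.comp (f := fun x : Pt d => ((0, r), x)) (by fun_prop)
  rw [← integral_sub (integrableOn_cell iP) (integrableOn_cell iF), ← integral_neg]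
  have hc0 : c (0, r) = u r := by ext x; simp [c]
  refine integral_congr_ae (Eventually.of_forall fun x => ?_)
  simp only [P, hc0, Real.cos_zero, neg_mul, hV₁.div_self_sq_mul_deriv (hu.2 r x),
    hV₂.div_self_sq_mul_deriv (hu.2 r x)]
  ring

variable {S : Set ℝ} {𝒰 : ℝ → (Pt d → ℝ) → EReal}

theorem HasSpaceTimeVariationAt.exists_space {s τ : ℝ} (hs : s ∈ S) {w Φ : Pt d → ℝ}
    (h : HasSpaceTimeVariationAt b S 𝒰 s w τ Φ) {c : ℝ → Pt d → ℝ} (hc : IsDensityFamily b c)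
    (hc0 : c 0 = w) {k : Pt d → ℝ} (hk : ∀ x, HasDerivAt (fun e => c e x) (k x) 0) :
    ∃ g : ℝ → ℝ, (∀ᶠ e in 𝓝 0, 𝒰 s (c e) = g e) ∧
      HasDerivAt g (∫ x in parallelepiped b, Φ x * k x) 0 := by
  obtain ⟨g, hg, hd⟩ := h.2 (fun _ => s) c contDiff_const hc rfl hc0
  have hS : (fun _ : ℝ => s) ⁻¹' S = univ := by simp [hs]
  rw [hS] at hg hd
  rw [nhdsWithin_univ] at hg
  refine ⟨g, hg, (hasDerivWithinAt_univ.1 hd).congr_deriv ?_⟩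
  simp [(hk _).deriv]

theorem HasSpaceTimeVariationAt.exists_real {s τ : ℝ} (hs : s ∈ S) {w Φ : Pt d → ℝ}
    (hw : IsDensity b w) (h : HasSpaceTimeVariationAt b S 𝒰 s w τ Φ) :
    ∃ g : ℝ, 𝒰 s w = g := by
  obtain ⟨g, hg, -⟩ := h.exists_space hs (c := fun _ => w) (k := 0)
    ⟨⟨hw.1.1.comp contDiff_snd, fun _ => hw.1.2⟩, fun _ => hw.2⟩ rfl
    fun x => hasDerivAt_const _ _
  exact ⟨g 0, hg.self_of_nhds⟩

/-- Positive variations of a curve of densities in a given direction, on a given time interval. -/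
theorem exists_variation {u : ℝ → Pt d → ℝ} (hu : IsDensityFamily b u) {k : Pt d → ℝ}
    (hk : IsSmoothPeriodic b k) {s s' : ℝ} (hs : s < s') :
    ∃ κ > 0, ∃ h : ℝ → Pt d → ℝ, (∀ r ∈ Icc s s', ∀ᶠ r' in 𝓝 r, h r' = fun x => κ * k x) ∧
      IsSmoothFamily b h ∧
      IsDensityFamily b fun (q : ℝ × ℝ) x => u q.2 x + Real.sin q.1 * h q.2 x := by
  -- The cutoff is `1` on a neighbourhood of `[s, s']`, so the variation does not alter velocities
  -- there. Its compact support leaves only compactly many times at which positivity is at stake,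
  -- and `κ` below keeps the perturbation under half the minimum of `u`.
  let χ : ContDiffBump ((s + s') / 2) := ⟨(s' - s) / 2 + 1, (s' - s) / 2 + 2, by linarith,
    by linarith⟩
  have hχs : ContDiff ℝ ∞ χ := χ.contDiff
  obtain ⟨δ, hδ, hle⟩ := exists_pos_forall_le_of_periodic hu.1.1.continuous hu.1.2 hu.2
    (isCompact_closedBall ((s + s') / 2) ((s' - s) / 2 + 2))
  obtain ⟨C, hC, hkC⟩ := exists_forall_abs_le_of_periodic hk.1.continuous hk.2
  let κ : ℝ := δ / (2 * C)
  have hκ : 0 < κ := by positivity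
  let h : ℝ → Pt d → ℝ := fun r x => κ * (χ r * k x)
  have hhs : ContDiff ℝ ∞ fun q : ℝ × Pt d => h q.1 q.2 :=
    contDiff_const.mul ((hχs.comp contDiff_fst).mul (hk.1.comp contDiff_snd))
  refine ⟨κ, hκ, h, fun r hr => ?_, ⟨hhs, fun r x i => by simp only [h, hk.2]⟩, ⟨⟨?_, ?_⟩, ?_⟩⟩
  · have hmem : Metric.ball ((s + s') / 2) ((s' - s) / 2 + 1) ∈ 𝓝 r := by
      refine Metric.isOpen_ball.mem_nhds ?_
      rw [Metric.mem_ball, Real.dist_eq, abs_lt]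
      constructor <;> linarith [hr.1, hr.2]
    filter_upwards [hmem] with r' hr'
    ext x
    simp only [h]
    rw [χ.one_of_mem_closedBall (Metric.ball_subset_closedBall hr'), one_mul]
  · have e1 : ContDiff ℝ ∞ fun q : (ℝ × ℝ) × Pt d => u q.1.2 q.2 :=
      hu.1.1.comp (g := fun q : ℝ × Pt d => u q.1 q.2)
        (f := fun q : (ℝ × ℝ) × Pt d => (q.1.2, q.2)) (by fun_prop)
    have e2 : ContDiff ℝ ∞ fun q : (ℝ × ℝ) × Pt d => h q.1.2 q.2 :=
      hhs.comp (g := fun q : ℝ × Pt d => h q.1 q.2)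
        (f := fun q : (ℝ × ℝ) × Pt d => (q.1.2, q.2)) (by fun_prop)
    exact e1.add ((Real.contDiff_sin.comp (contDiff_fst.comp contDiff_fst)).mul e2)
  · intro q x i
    simp only [h, hk.2, hu.1.2]
  · intro q x
    by_cases hq : q.2 ∈ Metric.closedBall ((s + s') / 2) ((s' - s) / 2 + 2)
    · have h1 := hle q.2 hq x
      have h2 : |Real.sin q.1 * h q.2 x| ≤ δ / 2 := by
        simp only [h, abs_mul]
        rw [abs_of_pos hκ, abs_of_nonneg χ.nonneg]
        calc |Real.sin q.1| * (κ * (χ q.2 * |k x|)) ≤ 1 * (κ * (1 * C)) := by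
              gcongr
              · exact mul_nonneg hκ.le (mul_nonneg χ.nonneg (abs_nonneg _))
              · exact Real.abs_sin_le_one _
              · exact χ.le_one
              · exact hkC x
          _ = δ / 2 := by simp only [κ]; field_simp
      have h3 := neg_abs_le (Real.sin q.1 * h q.2 x)
      linarith
    · have : χ q.2 = 0 := χ.zero_of_le_dist (by
        rw [Metric.mem_closedBall, not_le] at hq
        exact hq.le)
      simp only [h, this, zero_mul, mul_zero, add_zero]
      exact hu.2 _ _

/-- If `𝒰` increases along paths at most by the action, with equality along `u`, then its first
variation changes along `u` by the first variation of the action. -/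
theorem integral_momentum_sub (hV₁ : IsMobility V₁) (hV₂ : IsMobility V₂)
    (hF : IsEnergy b F dF) {u : ℝ → Pt d → ℝ} {v₁ : ℝ → Pt d → Pt d} {v₂ : ℝ → Pt d → ℝ}
    (hu : IsDensityFamily b u)
    (hv₁ : Continuous fun q : ℝ × Pt d => v₁ q.1 q.2)
    (hv₂ : Continuous fun q : ℝ × Pt d => v₂ q.1 q.2) {s s' τ τ' : ℝ} {Φ Φ' : Pt d → ℝ}
    (hs : s ∈ S) (hs' : s' ∈ S) (hss : s < s')
    (hU : HasSpaceTimeVariationAt b S 𝒰 s (u s) τ Φ)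
    (hU' : HasSpaceTimeVariationAt b S 𝒰 s' (u s') τ' Φ')
    (hle : ∀ p, IsDensityFamily b p →
      (∀ r ∈ Icc s s', ∀ x, HasDerivAt (fun r => p r x) (deriv (fun r => u r x) r) r) →
      ∀ g : ℝ, 𝒰 s (p s) = g → 𝒰 s' (p s')
        ≤ ((g + ∫ r in s..s', fluxLagrangian b V₁ V₂ F (u r) (v₁ r) (v₂ r) (p r) : ℝ) : EReal))
    (heq : ∀ g : ℝ, 𝒰 s (u s) = g → 𝒰 s' (u s')
        = ((g + ∫ r in s..s', fluxLagrangian b V₁ V₂ F (u r) (v₁ r) (v₂ r) (u r) : ℝ) : EReal))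
    {k : Pt d → ℝ} (hk : IsSmoothPeriodic b k) :
    (∫ x in parallelepiped b, Φ' x * k x) - ∫ x in parallelepiped b, Φ x * k x
      = -∫ r in s..s', ∫ x in parallelepiped b,
        ((1 / 2) * ‖v₁ r x‖ ^ 2 * deriv V₁ (u r x) + (1 / 2) * |v₂ r x| ^ 2 * deriv V₂ (u r x)
          + dF (u r) x) * k x := by
  obtain ⟨κ, hκ, h, hhκ, hh, hc⟩ := exists_variation hu hk hss
  have hh' : ∀ r ∈ Icc s s', h r = fun x => κ * k x := fun r hr => (hhκ r hr).self_of_nhds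
  have hJ := hasDerivAt_integral_fluxLagrangian hV₁ hV₂ hF hu hc hh.1.continuous hv₁ hv₂ hss.le
  let c : ℝ → ℝ → Pt d → ℝ := fun e r x => u r x + Real.sin e * h r x
  have hcr : ∀ r, IsDensityFamily b fun e => c e r := fun r =>
    hc.comp (f := fun e : ℝ => (e, r)) (contDiff_id.prodMk contDiff_const)
  have hce : ∀ e, IsDensityFamily b (c e) := fun e =>
    hc.comp (f := fun r : ℝ => (e, r)) (contDiff_const.prodMk contDiff_id)
  have hc0 : ∀ r, c 0 r = u r := fun r => by ext x; simp [c]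
  have hcd : ∀ r x, HasDerivAt (fun e => c e r x) (h r x) 0 := fun r x => by
    have := ((Real.hasDerivAt_sin 0).mul_const (h r x)).const_add (u r x)
    rw [Real.cos_zero, one_mul] at this
    exact this
  obtain ⟨g, hg, hgd⟩ := hU.exists_space hs (hcr s) (hc0 s) (hcd s)
  obtain ⟨g', hg', hgd'⟩ := hU'.exists_space hs' (hcr s') (hc0 s') (hcd s')
  have hD := (hgd.add hJ).sub hgd'
  -- By `hle` this function is nonnegative near `0`, since the variations share the velocity of `u`
  -- on `[s, s']`; by `heq` it vanishes at `0`.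
  have hmin : IsLocalMin (g + (fun e => ∫ r in s..s', fluxLagrangian b V₁ V₂ F (u r) (v₁ r) (v₂ r)
      (fun x => u r x + Real.sin e * h r x)) - g') 0 := by
    have e0 := heq (g 0) (by rw [← hc0 s]; exact hg.self_of_nhds)
    rw [← hc0 s', hg'.self_of_nhds, EReal.coe_eq_coe_iff] at e0
    filter_upwards [hg, hg'] with e he he'
    have h1 := hle (c e) (hce e) (fun r hr x => by
      have h2 : (fun r => c e r x) =ᶠ[𝓝 r] fun r => u r x + Real.sin e * (κ * k x) := by
        filter_upwards [hhκ r hr] with r' hr'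
        simp only [c, hr']
      exact ((hu.1.hasDerivAt r x).add_const _).congr_of_eventuallyEq h2) (g e) he
    rw [he', EReal.coe_le_coe_iff] at h1
    simp only [Pi.sub_apply, Pi.add_apply, Real.sin_zero, zero_mul, add_zero]
    have : (∫ r in s..s', fluxLagrangian b V₁ V₂ F (u r) (v₁ r) (v₂ r) fun x => u r x)
        = ∫ r in s..s', fluxLagrangian b V₁ V₂ F (u r) (v₁ r) (v₂ r) (u r) := rfl
    rw [this]
    linarith
  have hz := hmin.hasDerivAt_eq_zero hD
  have e1 : (∫ r in s..s', ∫ x in parallelepiped b,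
        ((1 / 2) * ‖v₁ r x‖ ^ 2 * deriv V₁ (u r x) + (1 / 2) * |v₂ r x| ^ 2 * deriv V₂ (u r x)
          + dF (u r) x) * h r x)
      = κ * ∫ r in s..s', ∫ x in parallelepiped b,
        ((1 / 2) * ‖v₁ r x‖ ^ 2 * deriv V₁ (u r x) + (1 / 2) * |v₂ r x| ^ 2 * deriv V₂ (u r x)
          + dF (u r) x) * k x := by
    rw [← intervalIntegral.integral_const_mul]
    refine intervalIntegral.integral_congr fun r hr => ?_
    rw [uIcc_of_le hss.le] at hr
    simp only [hh' r hr]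
    rw [← integral_const_mul]
    exact integral_congr_ae (Eventually.of_forall fun x => by ring)
  have e2 : ∀ Ψ : Pt d → ℝ, ∀ r ∈ Icc s s', ∫ x in parallelepiped b, Ψ x * h r x
      = κ * ∫ x in parallelepiped b, Ψ x * k x := fun Ψ r hr => by
    rw [← integral_const_mul, hh' r hr]
    exact integral_congr_ae (Eventually.of_forall fun x => by ring)
  rw [e1, e2 Φ s ⟨le_rfl, hss.le⟩, e2 Φ' s' ⟨hss.le, le_rfl⟩] at hz
  refine mul_left_cancel₀ hκ.ne' ?_
  linarith

/-- Fubini's theorem turns the weak identity into the orthogonality of `Φ' - Φ + ∫ K` to every test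
function, and the fundamental lemma makes it pointwise. -/
theorem momentum_sub_eq (hV₁ : IsMobility V₁) (hV₂ : IsMobility V₂)
    (hF : IsEnergy b F dF) {u : ℝ → Pt d → ℝ} {v₁ : ℝ → Pt d → Pt d} {v₂ : ℝ → Pt d → ℝ}
    (hu : IsDensityFamily b u)
    (hv₁ : Continuous fun q : ℝ × Pt d => v₁ q.1 q.2) (hv₁p : ∀ r x i, v₁ r (x + b i) = v₁ r x)
    (hv₂ : Continuous fun q : ℝ × Pt d => v₂ q.1 q.2) (hv₂p : ∀ r x i, v₂ r (x + b i) = v₂ r x)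
    {s s' τ τ' : ℝ} {Φ Φ' : Pt d → ℝ}
    (hs : s ∈ S) (hs' : s' ∈ S) (hss : s < s')
    (hU : HasSpaceTimeVariationAt b S 𝒰 s (u s) τ Φ)
    (hU' : HasSpaceTimeVariationAt b S 𝒰 s' (u s') τ' Φ')
    (hle : ∀ p, IsDensityFamily b p →
      (∀ r ∈ Icc s s', ∀ x, HasDerivAt (fun r => p r x) (deriv (fun r => u r x) r) r) →
      ∀ g : ℝ, 𝒰 s (p s) = g → 𝒰 s' (p s')
        ≤ ((g + ∫ r in s..s', fluxLagrangian b V₁ V₂ F (u r) (v₁ r) (v₂ r) (p r) : ℝ) : EReal))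
    (heq : ∀ g : ℝ, 𝒰 s (u s) = g → 𝒰 s' (u s')
        = ((g + ∫ r in s..s', fluxLagrangian b V₁ V₂ F (u r) (v₁ r) (v₂ r) (u r) : ℝ) : EReal))
    (x : Pt d) :
    Φ' x - Φ x = -∫ r in s..s',
        ((1 / 2) * ‖v₁ r x‖ ^ 2 * deriv V₁ (u r x) + (1 / 2) * |v₂ r x| ^ 2 * deriv V₂ (u r x)
          + dF (u r) x) := by
  let K : ℝ → Pt d → ℝ := fun r x =>
    (1 / 2) * ‖v₁ r x‖ ^ 2 * deriv V₁ (u r x) + (1 / 2) * |v₂ r x| ^ 2 * deriv V₂ (u r x)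
      + dF (u r) x
  have hKdef : ∀ r x, (1 / 2) * ‖v₁ r x‖ ^ 2 * deriv V₁ (u r x)
      + (1 / 2) * |v₂ r x| ^ 2 * deriv V₂ (u r x) + dF (u r) x = K r x := fun _ _ => rfl
  have hpos : ∀ q : ℝ × Pt d, 0 < u q.1 q.2 := fun q => hu.2 _ _
  have d1 : Continuous fun q : ℝ × Pt d => deriv V₁ (u q.1 q.2) :=
    hV₁.continuousOn_deriv.comp_continuous hu.1.1.continuous hpos
  have d2 : Continuous fun q : ℝ × Pt d => deriv V₂ (u q.1 q.2) :=
    hV₂.continuousOn_deriv.comp_continuous hu.1.1.continuous hpos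
  have dc : Continuous fun q : ℝ × Pt d => dF (u q.1) q.2 :=
    (hF.continuous (fun q => u q.2) (hu.comp contDiff_snd)).comp
      (f := fun q : ℝ × Pt d => ((0, q.1), q.2)) (by fun_prop)
  have hK : Continuous fun q : ℝ × Pt d => K q.1 q.2 :=
    (continuous_kineticDensity hv₁ d1 hv₂ d2).add dc
  have hKper : ∀ r x i, K r (x + b i) = K r x := fun r x i => by
    simp only [K, hv₁p, hv₂p, hu.1.2, hF.periodic _ (hu.isDensity r)]
  have hsub := fun k (hk : IsSmoothPeriodic b k) =>
    integral_momentum_sub hV₁ hV₂ hF hu hv₁ hv₂ hs hs' hss hU hU' hle heq hk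
  simp only [hKdef] at hsub ⊢
  clear_value K
  have hIc : Continuous fun x => ∫ r in s..s', K r x := by
    simp only [intervalIntegral.integral_of_le hss.le, ← integral_Icc_eq_integral_Ioc]
    exact continuous_parametric_integral_of_continuous (f := fun x r => K r x)
      (hK.comp continuous_swap) isCompact_Icc
  have hfun := eq_zero_of_forall_integral_mul_eq_zero (b := b)
    (f := fun x => Φ' x - Φ x + ∫ r in s..s', K r x)
    ((hU'.1.1.continuous.sub hU.1.1.continuous).add hIc)
    (fun x i => by simp only [hU'.1.2, hU.1.2, hKper]) (fun k hk => by
      have h1 := hsub k hk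
      have hkc := hk.1.continuous
      have cΦ := hU.1.1.continuous
      have cΦ' := hU'.1.1.continuous
      have hswap : ∫ r in s..s', ∫ x in parallelepiped b, K r x * k x
          = ∫ x in parallelepiped b, (∫ r in s..s', K r x) * k x := by
        simp only [intervalIntegral.integral_of_le hss.le, ← integral_Icc_eq_integral_Ioc]
        rw [integral_integral_swap]
        · exact integral_congr_ae (Eventually.of_forall fun x => integral_mul_const _ _)
        · rw [Measure.prod_restrict]
          have hKk : Continuous fun q : ℝ × Pt d => K q.1 q.2 * k q.2 :=
            hK.mul (hkc.comp continuous_snd)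
          exact hKk.continuousOn.integrableOn_compact (isCompact_Icc.prod (isCompact_cell b))
      have e : ∀ x, (Φ' x - Φ x + ∫ r in s..s', K r x) * k x
          = Φ' x * k x - Φ x * k x + (∫ r in s..s', K r x) * k x := fun x => by ring
      simp only [e]
      have i1 : Continuous fun x => Φ' x * k x := cΦ'.mul hkc
      have i2 : Continuous fun x => Φ x * k x := cΦ.mul hkc
      have i12 : Continuous fun x => Φ' x * k x - Φ x * k x := i1.sub i2
      have i3 : Continuous fun x => (∫ r in s..s', K r x) * k x := hIc.mul hkc
      rw [integral_add (integrableOn_cell i12) (integrableOn_cell i3),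
        integral_sub (integrableOn_cell i1) (integrableOn_cell i2), h1, ← hswap]
      exact neg_add_cancel _)
  have := congrFun hfun x
  simp only [Pi.zero_apply] at this
  exact eq_neg_of_add_eq_zero_left this

/-- Freezing time outside `[s, s']` gives globally continuous controls, as the variational lemmas
require, when continuity is known only on an open time interval. -/
theorem exists_continuous_clamp {X : Type*} [TopologicalSpace X] {v : ℝ → Pt d → X} {a a' s s' : ℝ}
    (hv : ContinuousOn (fun q : ℝ × Pt d => v q.1 q.2) (Ioo a a' ×ˢ univ)) (ha : a < s)
    (hs : s ≤ s') (ha' : s' < a') :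
    ∃ v' : ℝ → Pt d → X, (Continuous fun q : ℝ × Pt d => v' q.1 q.2) ∧
      (∀ r ∈ Icc s s', v' r = v r) ∧ ∀ r, ∃ r' ∈ Ioo a a', v' r = v r' := by
  refine ⟨fun r => v (projIcc s s' hs r), ?_, fun r hr => ?_, fun r => ⟨projIcc s s' hs r, ?_, rfl⟩⟩
  · refine hv.comp_continuous (f := fun q : ℝ × Pt d => ((projIcc s s' hs q.1 : ℝ), q.2)) ?_
      fun q => ⟨?_, mem_univ _⟩
    · exact (continuous_subtype_val.comp (continuous_projIcc.comp continuous_fst)).prodMk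
        continuous_snd
    · have := (projIcc s s' hs q.1).2
      exact ⟨ha.trans_le this.1, this.2.trans_lt ha'⟩
  · simp only [projIcc_of_mem hs hr]
  · have := (projIcc s s' hs r).2
    exact ⟨ha.trans_le this.1, this.2.trans_lt ha'⟩

/-- The momentum equation along a characteristic curve. -/
theorem hasDerivAt_momentum (hV₁ : IsMobility V₁) (hV₂ : IsMobility V₂)
    (hF : IsEnergy b F dF) {u : ℝ → Pt d → ℝ} {v₁ : ℝ → Pt d → Pt d} {v₂ : ℝ → Pt d → ℝ}
    {a a' : ℝ} {τ : ℝ → ℝ} {Φ : ℝ → Pt d → ℝ} (hu : IsDensityFamily b u) (hI : Ioo a a' ⊆ S)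
    (hv₁ : ContinuousOn (fun q : ℝ × Pt d => v₁ q.1 q.2) (Ioo a a' ×ˢ univ))
    (hv₁p : ∀ r ∈ Ioo a a', ∀ x i, v₁ r (x + b i) = v₁ r x)
    (hv₂ : ContinuousOn (fun q : ℝ × Pt d => v₂ q.1 q.2) (Ioo a a' ×ˢ univ))
    (hv₂p : ∀ r ∈ Ioo a a', ∀ x i, v₂ r (x + b i) = v₂ r x)
    (hU : ∀ s ∈ Ioo a a', HasSpaceTimeVariationAt b S 𝒰 s (u s) (τ s) (Φ s))
    (hle : ∀ s ∈ Ioo a a', ∀ s' ∈ Ioo a a', s < s' → ∀ p, IsDensityFamily b p →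
      (∀ r ∈ Icc s s', ∀ x, HasDerivAt (fun r => p r x) (deriv (fun r => u r x) r) r) →
      ∀ g : ℝ, 𝒰 s (p s) = g → 𝒰 s' (p s')
        ≤ ((g + ∫ r in s..s', fluxLagrangian b V₁ V₂ F (u r) (v₁ r) (v₂ r) (p r) : ℝ) : EReal))
    (heq : ∀ s ∈ Ioo a a', ∀ s' ∈ Ioo a a', s < s' → ∀ g : ℝ, 𝒰 s (u s) = g → 𝒰 s' (u s')
        = ((g + ∫ r in s..s', fluxLagrangian b V₁ V₂ F (u r) (v₁ r) (v₂ r) (u r) : ℝ) : EReal))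
    {s : ℝ} (hs : s ∈ Ioo a a') (x : Pt d) :
    HasDerivAt (fun r => Φ r x) (-((1 / 2) * ‖v₁ s x‖ ^ 2 * deriv V₁ (u s x)
      + (1 / 2) * |v₂ s x| ^ 2 * deriv V₂ (u s x) + dF (u s) x)) s := by
  let K : ℝ → ℝ := fun r =>
    (1 / 2) * ‖v₁ r x‖ ^ 2 * deriv V₁ (u r x) + (1 / 2) * |v₂ r x| ^ 2 * deriv V₂ (u r x)
      + dF (u r) x
  have hsub : ∀ s ∈ Ioo a a', ∀ s' ∈ Ioo a a', s < s' →
      Φ s' x - Φ s x = -∫ r in s..s', K r := by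
    intro s hs s' hs' hss
    obtain ⟨w₁, hw₁, hw₁e, hw₁r⟩ := exists_continuous_clamp hv₁ hs.1 hss.le hs'.2
    obtain ⟨w₂, hw₂, hw₂e, hw₂r⟩ := exists_continuous_clamp hv₂ hs.1 hss.le hs'.2
    have hfl : ∀ p : ℝ → Pt d → ℝ,
        ∫ r in s..s', fluxLagrangian b V₁ V₂ F (u r) (w₁ r) (w₂ r) (p r)
          = ∫ r in s..s', fluxLagrangian b V₁ V₂ F (u r) (v₁ r) (v₂ r) (p r) := fun p =>
      intervalIntegral.integral_congr fun r hr => by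
        rw [uIcc_of_le hss.le] at hr
        simp only [hw₁e r hr, hw₂e r hr]
    rw [momentum_sub_eq hV₁ hV₂ hF hu hw₁
      (fun r y i => by obtain ⟨r', hr', e⟩ := hw₁r r; rw [e, hv₁p r' hr'])
      hw₂ (fun r y i => by obtain ⟨r', hr', e⟩ := hw₂r r; rw [e, hv₂p r' hr'])
      (hI hs) (hI hs') hss (hU s hs) (hU s' hs')
      (by simpa only [hfl] using hle s hs s' hs' hss)
      (by simpa only [hfl] using heq s hs s' hs' hss)]
    congr 1
    refine intervalIntegral.integral_congr fun r hr => ?_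
    rw [uIcc_of_le hss.le] at hr
    simp only [hw₁e r hr, hw₂e r hr, K]
  have hsl : ContinuousOn (fun r : ℝ => (r, x)) (Ioo a a') := by fun_prop
  have hmaps : MapsTo (fun r : ℝ => (r, x)) (Ioo a a') (Ioo a a' ×ˢ univ) :=
    fun r hr => ⟨hr, mem_univ _⟩
  have cv₁ : ContinuousOn (fun r => v₁ r x) (Ioo a a') := hv₁.comp hsl hmaps
  have cv₂ : ContinuousOn (fun r => v₂ r x) (Ioo a a') := hv₂.comp hsl hmaps
  have cu : Continuous fun r => u r x := hu.1.1.continuous.comp (by fun_prop : Continuous fun r => (r, x))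
  have d1 : Continuous fun r => deriv V₁ (u r x) :=
    hV₁.continuousOn_deriv.comp_continuous cu fun r => hu.2 r x
  have d2 : Continuous fun r => deriv V₂ (u r x) :=
    hV₂.continuousOn_deriv.comp_continuous cu fun r => hu.2 r x
  have dc : Continuous fun r => dF (u r) x :=
    (hF.continuous (fun q => u q.2) (hu.comp contDiff_snd)).comp
      (f := fun r : ℝ => ((0, r), x)) (by fun_prop)
  have hK : ContinuousOn K (Ioo a a') :=
    (((continuousOn_const.mul (cv₁.norm.pow 2)).mul d1.continuousOn).add
      ((continuousOn_const.mul (cv₂.abs.pow 2)).mul d2.continuousOn)).add dc.continuousOn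
  -- With a base point strictly before `s`, the integral identity holds on both sides of `s`, so a
  -- two-sided derivative results.
  obtain ⟨s₀, h0, h1⟩ := exists_between hs.1
  have hs₀ : s₀ ∈ Ioo a a' := ⟨h0, h1.trans hs.2⟩
  have hnhds : Ioo a a' ∈ 𝓝 s := isOpen_Ioo.mem_nhds hs
  have hint : HasDerivAt (fun r => ∫ y in s₀..r, K y) (K s) s :=
    intervalIntegral.integral_hasDerivAt_right
      ((hK.mono (by rw [uIcc_of_le h1.le]; exact fun r hr => ⟨h0.trans_le hr.1,
        hr.2.trans_lt hs.2⟩)).intervalIntegrable)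
      (hK.stronglyMeasurableAtFilter isOpen_Ioo s hs) (hK.continuousAt hnhds)
  refine (hint.neg.const_add (Φ s₀ x)).congr_of_eventuallyEq ?_
  filter_upwards [hnhds, Ioi_mem_nhds h1] with r hr hr'
  have := hsub s₀ hs₀ r hr hr'
  simp only [Pi.neg_apply]
  linarith

end Momentum

/-! ### Hamiltonian flow along minimizers and along characteristics -/

section Characteristics

variable {d : ℕ} {b : Module.Basis (Fin d) ℝ (Pt d)} {V₁ V₂ : ℝ → ℝ}
  {F : (Pt d → ℝ) → ℝ} {dF : (Pt d → ℝ) → Pt d → ℝ}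

/-- A path with the velocity of a controlled path is controlled, with the same fluxes. -/
theorem IsControlledPath.of_hasDerivAt (hV₁ : IsMobility V₁) (hV₂ : IsMobility V₂) {s s' : ℝ}
    {u p : ℝ → Pt d → ℝ} {v₁ : ℝ → Pt d → Pt d} {v₂ : ℝ → Pt d → ℝ}
    (h : IsControlledPath b V₁ V₂ s s' u v₁ v₂) (hp : IsDensityFamily b p)
    (hd : ∀ r ∈ Icc s s', ∀ x, HasDerivAt (fun r => p r x) (deriv (fun r => u r x) r) r) :
    IsControlledPath b V₁ V₂ s s' p (fun r x => (V₁ (u r x) / V₁ (p r x)) • v₁ r x)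
      (fun r x => (V₂ (u r x) / V₂ (p r x)) * v₂ r x) := by
  have hu := h.density
  refine ⟨hp, ⟨?_, fun r x i => ?_⟩, ⟨?_, fun r x i => ?_⟩, fun r hr x => ?_⟩
  · exact (hV₁.contDiff_div hu.1.1 hp.1.1 (fun q => hu.2 q.1 q.2) fun q => hp.2 q.1 q.2).smul
      h.transport.1
  · simp only [hu.1.2, hp.1.2, h.transport.2]
  · exact (hV₂.contDiff_div hu.1.1 hp.1.1 (fun q => hu.2 q.1 q.2) fun q => hp.2 q.1 q.2).mul
      h.reaction.1
  · simp only [hu.1.2, hp.1.2, h.reaction.2]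
  · refine (hd r hr x).congr_deriv ?_
    rw [(h.equation r hr x).deriv]
    simp only [smul_smul, hV₁.mul_div (hu.2 r _) (hp.2 r _)]
    linear_combination -v₂ r x * hV₂.mul_div (hu.2 r x) (hp.2 r x)

variable {D : Set (Pt d → ℝ)} {ψ : (Pt d → ℝ) → ℝ}

/-- Along a minimizer the momentum is the first variation of the value functional, and it solves
the mean-field Hamiltonian flow. -/
theorem IsMinimizer.hamiltonianFlow (hV₁ : IsMobility V₁) (hV₂ : IsMobility V₂)
    (hF : IsEnergy b F dF) {t : ℝ} (ht : t ∈ Ioc (0 : ℝ) 1) {u : ℝ → Pt d → ℝ}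
    {v₁ : ℝ → Pt d → Pt d} {v₂ : ℝ → Pt d → ℝ} {τ : ℝ → ℝ} {Φ : ℝ → Pt d → ℝ}
    (hmin : IsMinimizer b V₁ V₂ F D ψ t u v₁ v₂)
    (hU : ∀ s ∈ Ioo 0 t, HasSpaceTimeVariationAt b (Icc 0 1) (valueFunctional b V₁ V₂ F D ψ)
        s (u s) (τ s) (Φ s)) :
    (∀ s ∈ Ioo 0 t, MeanField.hamiltonJacobi b V₁ V₂ F (u s) (τ s) (Φ s) = 0) ∧
      (∀ s ∈ Ioo 0 t, ∀ x, (V₁ (u s x) ≠ 0 → v₁ s x = gradient (Φ s) x) ∧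
        (V₂ (u s x) ≠ 0 → v₂ s x = Φ s x)) ∧
      IsHamiltonianFlow V₁ V₂ dF (Ioo 0 t) u Φ := by
  have hI : Ioo 0 t ⊆ Icc (0 : ℝ) 1 := fun s hs => ⟨hs.1.le, hs.2.le.trans ht.2⟩
  have hu := hmin.1.density
  -- Differentiability makes the value finite, and then the truncation to `[0, s]` is itself a
  -- minimizer, to which the endpoint result applies.
  have hval : ∀ s ∈ Ioo 0 t, valueFunctional b V₁ V₂ F D ψ s (u s)
      = ((ψ (u 0) + action b V₁ V₂ F 0 s u v₁ v₂ : ℝ) : EReal) := fun s hs => by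
    obtain ⟨g, hg⟩ := (hU s hs).exists_real (hI hs) (hu.isDensity s)
    rw [hg, hmin.valueFunctional_eq hV₁ hV₂ hF hs hg]
  have hHJ : ∀ s ∈ Ioo 0 t, MeanField.hamiltonJacobi b V₁ V₂ F (u s) (τ s) (Φ s) = 0 ∧
      ∀ x, (V₁ (u s x) ≠ 0 → v₁ s x = gradient (Φ s) x) ∧ (V₂ (u s x) ≠ 0 → v₂ s x = Φ s x) :=
    fun s hs => IsMinimizer.hamiltonJacobi hV₁ hV₂ hF ⟨hs.1, hs.2.le.trans ht.2⟩
      ⟨hmin.1.mono le_rfl hs.2.le, hmin.2.1, hval s hs⟩ (hU s hs)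
  refine ⟨fun s hs => (hHJ s hs).1, fun s hs => (hHJ s hs).2, fun s hs x => ⟨?_, ?_⟩⟩
  · refine (hmin.1.equation s ⟨hs.1.le, hs.2.le⟩ x).congr_deriv ?_
    have e1 : (fun y => V₁ (u s y) • v₁ s y) = fun y => V₁ (u s y) • gradient (Φ s) y := by
      ext1 y
      by_cases h : V₁ (u s y) = 0
      · simp [h]
      · rw [((hHJ s hs).2 y).1 h]
    have e2 : v₂ s x * V₂ (u s x) = V₂ (u s x) * Φ s x := by
      by_cases h : V₂ (u s x) = 0
      · simp [h]
      · rw [((hHJ s hs).2 x).2 h, mul_comm]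
    rw [e1, e2, densityVelocity]
  -- The inequality is dynamic programming along the path `p` with the fluxes of `u`; the equality
  -- is the principle of optimality.
  · have hmom := hasDerivAt_momentum hV₁ hV₂ hF hu hI hmin.1.transport.1.continuous.continuousOn
      (fun r _ => hmin.1.transport.2 r) hmin.1.reaction.1.continuous.continuousOn
      (fun r _ => hmin.1.reaction.2 r) hU
      (fun s hs s' hs' hss p hp hpd g hg => valueFunctional_le_add_action hV₁ hV₂ hF hs.1 hss
        ((hmin.1.mono hs.1.le hs'.2.le).of_hasDerivAt hV₁ hV₂ hp hpd) hg)
      (fun s hs s' hs' hss g hg => by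
        have hc := hmin.1.continuous_lagrangian hV₁ hV₂ hF
        rw [hval s' hs', hmin.valueFunctional_eq hV₁ hV₂ hF hs hg]
        simp only [fluxLagrangian_self, action_eq]
        rw [add_assoc, intervalIntegral.integral_add_adjacent_intervals
          (hc.intervalIntegrable _ _) (hc.intervalIntegrable _ _)]) hs x
    refine hmom.congr_deriv ?_
    rw [momentumForce]
    congr 3
    · by_cases h : V₁ (u s x) = 0
      · rw [hV₁.deriv_eq_zero (hu.2 s x) h, mul_zero, mul_zero]
      · rw [((hHJ s hs).2 x).1 h]
    · by_cases h : V₂ (u s x) = 0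
      · rw [hV₂.deriv_eq_zero (hu.2 s x) h, mul_zero, mul_zero]
      · rw [((hHJ s hs).2 x).2 h]

/-- The derivative of a functional along a curve. -/
theorem HasSpaceTimeVariationAt.hasDerivAt {S : Set ℝ} (hS : IsOpen S)
    {𝒲 : ℝ → (Pt d → ℝ) → ℝ} {s τ : ℝ} (hs : s ∈ S) {Φ : Pt d → ℝ} {p : ℝ → Pt d → ℝ}
    (h : HasSpaceTimeVariationAt b S (fun r p => (𝒲 r p : EReal)) s (p s) τ Φ)
    (hp : IsDensityFamily b p) :
    HasDerivAt (fun r => 𝒲 r (p r))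
      (τ + ∫ x in parallelepiped b, Φ x * deriv (fun r => p r x) s) s := by
  obtain ⟨g, hg, hd⟩ := h.2 (fun r => s + r) (fun r => p (s + r)) (by fun_prop)
    (hp.comp (by fun_prop)) (by simp) (by simp)
  have hn : (fun r => s + r) ⁻¹' S ∈ 𝓝 (0 : ℝ) :=
    (hS.preimage (by fun_prop)).mem_nhds (by simpa using hs)
  rw [nhdsWithin_eq_nhds.2 hn] at hg
  have hd' : HasDerivAt (fun r => 𝒲 (s + r) (p (s + r))) _ 0 :=
    (hd.hasDerivAt hn).congr_of_eventuallyEq (hg.mono fun r hr => EReal.coe_eq_coe_iff.1 hr)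
  have e1 : deriv (fun r => s + r) 0 = 1 := by rw [deriv_const_add]; simp
  have e2 : ∀ x, deriv (fun r => p (s + r) x) 0 = deriv (fun r => p r x) s := fun x => by
    rw [deriv_comp_const_add (f := fun r => p r x), add_zero]
  simp only [e1, e2, one_mul] at hd'
  have h2 : HasDerivAt (fun r : ℝ => r - s) 1 s := (hasDerivAt_id _).sub_const s
  rw [← sub_self s] at hd'
  simpa [Function.comp_def] using hd'.comp (h := fun r : ℝ => r - s) s h2

/-- The Hamiltonian flow is the characteristic system of the Hamilton–Jacobi equation. -/
theorem isHamiltonianFlow_of_hamiltonJacobi (hV₁ : IsMobility V₁) (hV₂ : IsMobility V₂)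
    (hF : IsEnergy b F dF) {t₀ t₁ : ℝ} {𝒲 τ : ℝ → (Pt d → ℝ) → ℝ}
    {δ𝒲 : ℝ → (Pt d → ℝ) → Pt d → ℝ} {u : ℝ → Pt d → ℝ}
    (hW : ∀ s ∈ Ioo t₀ t₁, ∀ w, IsDensity b w →
      HasSpaceTimeVariationAt b (Ioo t₀ t₁) (fun r p => (𝒲 r p : EReal)) s w (τ s w) (δ𝒲 s w) ∧
      hamiltonJacobi b V₁ V₂ F w (τ s w) (δ𝒲 s w) = 0)
    (hu : IsDensityFamily b u)
    (hΦ : ContinuousOn (fun q : ℝ × Pt d => δ𝒲 q.1 (u q.1) q.2) (Ioo t₀ t₁ ×ˢ univ))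
    (hgrad : ContinuousOn (fun q : ℝ × Pt d => gradient (δ𝒲 q.1 (u q.1)) q.2)
      (Ioo t₀ t₁ ×ˢ univ))
    (hvel : ∀ s ∈ Ioo t₀ t₁, ∀ x,
        HasDerivAt (fun r => u r x) (densityVelocity V₁ V₂ (u s) (δ𝒲 s (u s)) x) s) :
    IsHamiltonianFlow V₁ V₂ dF (Ioo t₀ t₁) u fun s => δ𝒲 s (u s) := by
  set Φ : ℝ → Pt d → ℝ := fun s => δ𝒲 s (u s) with hΦdef
  have hΦs : ∀ s ∈ Ioo t₀ t₁, IsSmoothPeriodic b (Φ s) := fun s hs =>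
    (hW s hs (u s) (hu.isDensity s)).1.1
  -- A verification argument: (HJ) at `(r, p r)` and the completed square express the growth of `𝒲`
  -- along `p` as the Lagrangian minus a nonnegative defect, which is zero for `p = u` by `hself`.
  have hder : ∀ p, IsDensityFamily b p → ∀ r ∈ Ioo t₀ t₁,
      (∀ x, deriv (fun r => p r x) r = deriv (fun r => u r x) r) →
      HasDerivAt (fun r => 𝒲 r (p r))
        (fluxLagrangian b V₁ V₂ F (u r) (gradient (Φ r)) (Φ r) (p r)
          - kineticEnergy b V₁ V₂ (p r)
            (fun x => (V₁ (u r x) / V₁ (p r x)) • gradient (Φ r) x - gradient (δ𝒲 r (p r)) x)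
            (fun x => (V₂ (u r x) / V₂ (p r x)) * Φ r x - δ𝒲 r (p r) x)) r := by
    intro p hp r hr hpd
    have hpr := hp.isDensity r
    have hur := hu.isDensity r
    obtain ⟨h1, h2⟩ := hW r hr (p r) hpr
    refine (h1.hasDerivAt isOpen_Ioo hr hp).congr_deriv ?_
    have hpow := integral_mul_velocity (V₁ := V₁) (V₂ := V₂) hV₁ hV₂ hpr h1.1
      (v₁ := fun x => (V₁ (u r x) / V₁ (p r x)) • gradient (Φ r) x)
      (v₂ := fun x => (V₂ (u r x) / V₂ (p r x)) * Φ r x)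
      ((hV₁.contDiff_div hur.1.1 hpr.1.1 hur.2 hpr.2).smul (hΦs r hr).contDiff_gradient)
      (fun x i => by rw [hur.1.2, hpr.1.2, gradient_periodic (hΦs r hr).2])
      ((hV₂.contDiff_div hur.1.1 hpr.1.1 hur.2 hpr.2).mul (hΦs r hr).1)
    have e : ∀ x, deriv (fun r => p r x) r
        = -divergence (fun y => V₁ (p r y) • ((V₁ (u r y) / V₁ (p r y)) • gradient (Φ r) y)) x
          + (V₂ (u r x) / V₂ (p r x)) * Φ r x * V₂ (p r x) := fun x => by
      rw [hpd x, (hvel r hr x).deriv, densityVelocity]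
      simp only [smul_smul, hV₁.mul_div (hur.2 _) (hpr.2 _)]
      change -divergence (fun y => V₁ (u r y) • gradient (Φ r) y) x + V₂ (u r x) * Φ r x = _
      linear_combination -Φ r x * hV₂.mul_div (hur.2 x) (hpr.2 x)
    rw [hamiltonJacobi_eq hV₁ hV₂ hpr h1.1] at h2
    simp only [e]
    rw [hpow, fluxLagrangian]
    linarith
  have hself : ∀ r, kineticEnergy b V₁ V₂ (u r)
      (fun x => (V₁ (u r x) / V₁ (u r x)) • gradient (Φ r) x - gradient (δ𝒲 r (u r)) x)
      (fun x => (V₂ (u r x) / V₂ (u r x)) * Φ r x - δ𝒲 r (u r) x) = 0 := by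
    intro r
    rw [kineticEnergy, ← integral_zero (α := Pt d) (G := ℝ)]
    refine integral_congr_ae (Eventually.of_forall fun x => ?_)
    by_cases h1 : V₁ (u r x) = 0 <;> by_cases h2 : V₂ (u r x) = 0 <;> simp [h1, h2, hΦdef]
  have hcont : ∀ s ∈ Ioo t₀ t₁, ∀ s' ∈ Ioo t₀ t₁, s < s' → ∀ p, IsDensityFamily b p →
      ContinuousOn (fun r => fluxLagrangian b V₁ V₂ F (u r) (gradient (Φ r)) (Φ r) (p r))
        (Icc s s') := by
    intro s hs s' hs' hss p hp
    obtain ⟨w₁, hw₁, hw₁e, -⟩ := exists_continuous_clamp (v := fun r => gradient (Φ r)) hgrad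
      hs.1 hss.le hs'.2
    obtain ⟨w₂, hw₂, hw₂e, -⟩ := exists_continuous_clamp (v := Φ) hΦ hs.1 hss.le hs'.2
    refine (continuous_fluxLagrangian hV₁ hV₂ hF hu hp hw₁ hw₂).continuousOn.congr fun r hr => ?_
    simp only [hw₁e r hr, hw₂e r hr]
  intro s hs x
  refine ⟨hvel s hs x, ?_⟩
  have hsub : ∀ s ∈ Ioo t₀ t₁, ∀ s' ∈ Ioo t₀ t₁, Icc s s' ⊆ Ioo t₀ t₁ := fun s hs s' hs' r hr =>
    ⟨hs.1.trans_le hr.1, hr.2.trans_lt hs'.2⟩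
  refine hasDerivAt_momentum hV₁ hV₂ hF hu (S := Ioo t₀ t₁)
    (𝒰 := fun r p => (𝒲 r p : EReal)) subset_rfl hgrad
    (fun r hr => gradient_periodic (hΦs r hr).2) hΦ (fun r hr => (hΦs r hr).2)
    (fun s hs => (hW s hs (u s) (hu.isDensity s)).1) ?_ ?_ hs x
  · intro s hs s' hs' hss p hp hpd g hg
    rw [EReal.coe_eq_coe_iff] at hg
    rw [EReal.coe_le_coe_iff, ← hg]
    have hd := fun r (hr : r ∈ Icc s s') => hder p hp r (hsub s hs s' hs' hr)
      fun y => (hpd r hr y).deriv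
    -- Nothing is known about the continuity of `δ𝒲` along `p`, so the defect need not be integrable
    -- in time; this form of the fundamental theorem needs only an integrable upper bound of the
    -- derivative.
    have := intervalIntegral.sub_le_integral_of_hasDeriv_right_of_le hss.le
      (fun r hr => (hd r hr).continuousAt.continuousWithinAt)
      (fun r hr => (hd r (Ioo_subset_Icc_self hr)).hasDerivWithinAt)
      ((hcont s hs s' hs' hss p hp).integrableOn_compact isCompact_Icc)
      (fun r hr => sub_le_self _ (kineticEnergy_nonneg hV₁ hV₂ (hp.isDensity r) _ _))
    linarith
  · intro s hs s' hs' hss g hg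
    rw [EReal.coe_eq_coe_iff] at hg
    rw [EReal.coe_eq_coe_iff, ← hg]
    have hd : ∀ r ∈ uIcc s s', HasDerivAt (fun r => 𝒲 r (u r))
        (fluxLagrangian b V₁ V₂ F (u r) (gradient (Φ r)) (Φ r) (u r)) r := fun r hr => by
      rw [uIcc_of_le hss.le] at hr
      have := hder u hu r (hsub s hs s' hs' hr) fun _ => rfl
      rwa [hself, sub_zero] at this
    rw [intervalIntegral.integral_eq_sub_of_hasDerivAt hd
      (ContinuousOn.intervalIntegrable (by
        rw [uIcc_of_le hss.le]
        exact hcont s hs s' hs' hss u hu))]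
    ring

end Characteristics

end MeanField

theorem mainTheorem4 {d : ℕ} (b : Module.Basis (Fin d) ℝ (Pt d)) (V₁ V₂ : ℝ → ℝ)
    (hV₁ : IsMobility V₁) (hV₂ : IsMobility V₂)
    (F : (Pt d → ℝ) → ℝ) (dF : (Pt d → ℝ) → Pt d → ℝ) (hF : IsEnergy b F dF) :
    -- The value functional satisfies the functional Hamilton–Jacobi equation.
    (∀ (D : Set (Pt d → ℝ)) (ψ : (Pt d → ℝ) → ℝ) (t : ℝ) (w : Pt d → ℝ) (τ : ℝ) (Φ : Pt d → ℝ),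
      t ∈ Ioc (0 : ℝ) 1 →
      (∃ u v₁ v₂, IsMinimizer b V₁ V₂ F D ψ t u v₁ v₂ ∧ u t = w) →
      HasSpaceTimeVariationAt b (Icc 0 1) (valueFunctional b V₁ V₂ F D ψ) t w τ Φ →
      hamiltonJacobi b V₁ V₂ F w τ Φ = 0) ∧
    -- Along a minimizer `u`, the momentum is `Φ = δ𝒰/δu`, the optimal controls are `∇Φ` and `Φ`,
    -- and `(u, Φ)` is a Hamiltonian flow.
    (∀ (D : Set (Pt d → ℝ)) (ψ : (Pt d → ℝ) → ℝ) (t : ℝ) (u : ℝ → Pt d → ℝ)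
      (v₁ : ℝ → Pt d → Pt d) (v₂ : ℝ → Pt d → ℝ) (τ : ℝ → ℝ) (Φ : ℝ → Pt d → ℝ),
      t ∈ Ioc (0 : ℝ) 1 →
      IsMinimizer b V₁ V₂ F D ψ t u v₁ v₂ →
      (∀ s ∈ Ioo 0 t, HasSpaceTimeVariationAt b (Icc 0 1) (valueFunctional b V₁ V₂ F D ψ)
        s (u s) (τ s) (Φ s)) →
      (∀ s ∈ Ioo 0 t, hamiltonJacobi b V₁ V₂ F (u s) (τ s) (Φ s) = 0) ∧
      (∀ s ∈ Ioo 0 t, ∀ x,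
        (V₁ (u s x) ≠ 0 → v₁ s x = gradient (Φ s) x) ∧
        (V₂ (u s x) ≠ 0 → v₂ s x = Φ s x)) ∧
      IsHamiltonianFlow V₁ V₂ dF (Ioo 0 t) u Φ) ∧
    -- The flow is Hamilton's system `∂_t u = δH/δΦ`, `∂_t Φ = -δH/δu`.
    (∀ u Φ : Pt d → ℝ, IsDensity b u → IsSmoothPeriodic b Φ →
      HasFreeFirstVariationAt b (fun Ψ => hamiltonian b V₁ V₂ F u Ψ) Φ
        (densityVelocity V₁ V₂ u Φ) ∧
      HasFirstVariationAt b (fun w => hamiltonian b V₁ V₂ F w Φ) u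
        (momentumForce V₁ V₂ dF u Φ)) ∧
    -- The flow is the characteristic system of every classical solution `𝒲` of the
    -- Hamilton–Jacobi equation, with `Φ = δ𝒲/δu`.
    (∀ (t₀ t₁ : ℝ) (𝒲 τ : ℝ → (Pt d → ℝ) → ℝ) (δ𝒲 : ℝ → (Pt d → ℝ) → Pt d → ℝ)
      (u : ℝ → Pt d → ℝ),
      (∀ s ∈ Ioo t₀ t₁, ∀ w, IsDensity b w →
        HasSpaceTimeVariationAt b (Ioo t₀ t₁) (fun r p => (𝒲 r p : EReal)) s w (τ s w) (δ𝒲 s w) ∧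
        hamiltonJacobi b V₁ V₂ F w (τ s w) (δ𝒲 s w) = 0) →
      IsDensityFamily b u →
      ContinuousOn (fun q : ℝ × Pt d => δ𝒲 q.1 (u q.1) q.2) (Ioo t₀ t₁ ×ˢ univ) →
      ContinuousOn (fun q : ℝ × Pt d => gradient (δ𝒲 q.1 (u q.1)) q.2) (Ioo t₀ t₁ ×ˢ univ) →
      (∀ s ∈ Ioo t₀ t₁, ∀ x,
        HasDerivAt (fun r => u r x) (densityVelocity V₁ V₂ (u s) (δ𝒲 s (u s)) x) s) →
      IsHamiltonianFlow V₁ V₂ dF (Ioo t₀ t₁) u (fun s => δ𝒲 s (u s))) := by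
  refine ⟨fun D ψ t w τ Φ ht hmin hU => ?_, fun D ψ t u v₁ v₂ τ Φ ht hmin hU =>
    hmin.hamiltonianFlow hV₁ hV₂ hF ht hU, fun u Φ hu hΦ =>
    ⟨hamiltonian_hasFreeFirstVariationAt hV₁ hV₂ hu hΦ,
      hamiltonian_hasFirstVariationAt hV₁ hV₂ hF hu hΦ⟩,
    fun t₀ t₁ 𝒲 τ δ𝒲 u hW hu hΦ hgrad hvel =>
      isHamiltonianFlow_of_hamiltonJacobi hV₁ hV₂ hF hW hu hΦ hgrad hvel⟩
  obtain ⟨u, v₁, v₂, hm, rfl⟩ := hmin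
  exact (hm.hamiltonJacobi hV₁ hV₂ hF ht hU).1
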